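/- **Conventions.** Fix a countably infinite set $\Delta$ of constants and an effectively coded supply of predicate symbols of each arity, each of which is either an OWA- or a CWA-predicate symbol (with recursive arity and kind), and of function symbols of each positive arity. A signature is any set of these symbols; its constants are elements of $\Delta$. Every finite object has a fixed effective injective code; "recursive" and "recursively enumerable" refer to codes. Logic is first-order logic with equality, over structures with nonempty domain. A *database signature* $\sigma_D\supseteq\Delta$ has no function symbols of positive arity; a *query signature* $\sigma_Q\supseteq\Delta$ has no CWA-predicate symbols. A *fact* over $\sigma_D$ is a ground atom $P(c_1,\dots,c_n)$ with $P\in\sigma_D$ and $c_i\in\Delta$. A *$\sigma_D$-database* is a partial function $D$ from the facts over $\sigma_D$ to $\{1,0,-1\}$ such that only finitely many facts have value $1$ or $0$ (these are the observed facts), $D$ is defined at every fact with a CWA-predicate symbol, and $D$ takes the value $-1$ only at such facts. $D$ is *positive* if it never takes the value $0$. $D_0$ *extends* $D$ if it does so as a partial function. For an injective $\tau:\Delta\to\Delta$, $\tau(\varphi)$ is $\varphi$ with each constant $c$ replaced by $\tau(c)$; $\tau(D)$ gives the fact $\tau(\alpha)$ the value (if any) of $D$ at $\alpha$, and leaves all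 facts not of the form $\tau(\alpha)$ unobserved (value $-1$ if CWA, undefined otherwise). A *query language* of $\sigma_Q$ is a recursive set $\mathcal Q$ of sentences of $\sigma_Q$ that is closed under $\wedge$ and under $\varphi\mapsto\tau(\varphi)$ for injective $\tau:\Delta\to\Delta$, and contains a sentence that is not a tautology. Let $\sigma_D$ be a database signature, $\sigma_Q$ a query signature, $\mathcal Q$ a query language of $\sigma_Q$, and $\mathcal D$ either the class of all $\sigma_D$-databases or the class of the positive ones. A *knowledge base* (KB) over $(\mathcal D,\mathcal Q)$ is a $K\subseteq\mathcal D\times\mathcal Q$ such that: (1) $(D,\varphi)\in K$ for all $D\in\mathcal D$ and tautologies $\varphi\in\mathcal Q$; (2) if $(D,\varphi)\in K$, $\psi\in\mathcal Q$ and $\varphi\models\psi$, then $(D,\psi)\in K$; (3) if $(D,\varphi),(D,\psi)\in K$, then $(D,\varphi\wedge\psi)\in K$; (4) if $(D,\varphi)\in K$ and $D_0\in\mathcal D$ extends $D$, then $(D_0,\varphi)\in K$; (5) if $(D,\varphi)\in K$ and $\tau:\Delta\to\Delta$ is injective, then $(\tau(D),\tau(\varphi))\in K$. A *knowledge representation formalism*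 (KRF) over $(\mathcal D,\mathcal Q)$ is a map $\Gamma$ from a recursive set $\mathrm{dom}(\Gamma)\subseteq\{0,1\}^*$ (the theories of $\Gamma$) to KBs over $(\mathcal D,\mathcal Q)$ for which there is a machine that, for all $\pi\in\mathrm{dom}(\Gamma)$, $D\in\mathcal D$, $\varphi\in\mathcal Q$, accepts (the code of) $(\pi,D,\varphi)$ if and only if $(D,\varphi)\in\Gamma(\pi)$. $\Gamma$ is *reducible* to $\Gamma_0$ if there is a recursive function $p:\mathrm{dom}(\Gamma)\to\mathrm{dom}(\Gamma_0)$ with $\Gamma=\Gamma_0\circ p$; they are *recursively isomorphic* if $p$ can be taken to be a bijection. A KRF $\Gamma$ is *universal* if every KRF over $(\mathcal D,\mathcal Q)$ is reducible to $\Gamma$. For a machine (program) $M$ let $\mathbb K(M)$ be the set of $(D,\varphi)\in\mathcal D\times\mathcal Q$ whose code $M$ accepts, and for $K\subseteq\mathcal D\times\mathcal Q$ let $\mathrm{cl}(K)$ be the least KB over $(\mathcal D,\mathcal Q)$ containing $K$. The *canonical KRF* $\Theta$ is the map whose theories are the binary codes $\ulcorner M\urcorner$ of machines $M$, with $\Theta(\ulcorner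 M\urcorner)=\mathrm{cl}(\mathbb K(M))$ (that is, $\ulcorner M\urcorner$ serves as description of the machine $M^*$ that accepts exactly $\mathrm{cl}(\mathbb K(M))$). **Theorem.** All universal KRFs over $(\mathcal D,\mathcal Q)$ are recursively isomorphic. Moreover, $\Theta$ is a universal KRF, and thus for each universal KRF $\Gamma$ over $(\mathcal D,\mathcal Q)$ there is a recursive bijection $p:\mathrm{dom}(\Gamma)\to\mathrm{dom}(\Theta)$ with $\Gamma=\Theta\circ p$. -/

import Mathlib

open scoped FirstOrder

namespace KRF

noncomputable section

/-! ### Symbols, signatures, sentences -/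

/-- The supply of non-logical symbols, with first-order logic (with equality) over it.
The function symbols of every arity are numbered by `ℕ`; those of arity `0` are the constants, and
they form the countably infinite set `Δ`. A predicate symbol of any arity is either
`Sum.inl i` (an OWA-predicate symbol) or `Sum.inr i` (a CWA-predicate symbol). -/
abbrev vocab : FirstOrder.Language.{0, 0} where
  Functions _ := ℕ
  Relations _ := ℕ ⊕ ℕ

/-- The set `Δ` of constants; it is the set `vocab.Functions 0` of nullary function symbols. -/
abbrev Const : Type := ℕ

abbrev Sentence : Type := vocab.Sentence

/-- `P` is a CWA-predicate symbol. -/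
def IsCWA {n : ℕ} (P : vocab.Relations n) : Prop := ∃ i, P = Sum.inr i

/-- A signature is an arbitrary set of predicate and function symbols. -/
structure Signature where
  preds : ∀ n, Set (vocab.Relations n)
  funcs : ∀ n, Set (vocab.Functions n)

/-- A database signature contains `Δ` and has no function symbols of positive arity. -/
def Signature.IsDatabaseSignature (σ : Signature) : Prop :=
  σ.funcs 0 = Set.univ ∧ ∀ n, σ.funcs (n + 1) = ∅

/-- A query signature contains `Δ` and has no CWA-predicate symbols. -/
def Signature.IsQuerySignature (σ : Signature) : Prop :=
  σ.funcs 0 = Set.univ ∧ ∀ n, ∀ P ∈ σ.preds n, ¬ IsCWA P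

/-- All function symbols of the term belong to `σ`. -/
def TermOver (σ : Signature) {α : Type} : vocab.Term α → Prop
  | .var _ => True
  | .func (l := n) f ts => f ∈ σ.funcs n ∧ ∀ i, TermOver σ (ts i)

/-- All non-logical symbols of the formula belong to `σ`. -/
def FormulaOver (σ : Signature) : ∀ {n : ℕ}, vocab.BoundedFormula Empty n → Prop
  | _, .falsum => True
  | _, .equal t u => TermOver σ t ∧ TermOver σ u
  | _, .rel (l := k) P ts => P ∈ σ.preds k ∧ ∀ i, TermOver σ (ts i)
  | _, .imp φ ψ => FormulaOver σ φ ∧ FormulaOver σ ψ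
  | _, .all φ => FormulaOver σ φ

/-- The logical implication `φ ⊨ ψ` (in all structures with nonempty domain). -/
def Entails (φ ψ : Sentence) : Prop := ({φ} : vocab.Theory) ⊨ᵇ ψ

/-- `φ` is a tautology, i.e. true in all structures (with nonempty domain). -/
def IsTautology (φ : Sentence) : Prop := (∅ : vocab.Theory) ⊨ᵇ φ

/-- The replacement of every constant `c` by `τ c`, as a map of the vocabulary to itself. -/
def renameHom (τ : Const ↪ Const) : vocab →ᴸ vocab where
  onFunction n f := match n with
    | 0 => τ f
    | _ + 1 => f
  onRelation _ P := P

/-- The sentence `τ(φ)`. -/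
def renameSentence (τ : Const ↪ Const) (φ : Sentence) : Sentence := (renameHom τ).onSentence φ

/-! ### Codes of sentences -/

def termCode {n : ℕ} : vocab.Term (Empty ⊕ Fin n) → ℕ
  | .var (Sum.inl e) => e.elim
  | .var (Sum.inr i) => 2 * (i : ℕ)
  | .func (l := k) f ts =>
      2 * Nat.pair (Nat.pair k f) (Encodable.encode (List.ofFn fun i => termCode (ts i))) + 1

def formulaCode : ∀ {n : ℕ}, vocab.BoundedFormula Empty n → ℕ
  | _, .falsum => 0
  | _, .equal t u => 4 * Nat.pair (termCode t) (termCode u) + 1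
  | _, .rel (l := k) P ts =>
      4 * Nat.pair (Nat.pair k (Encodable.encode P))
        (Encodable.encode (List.ofFn fun i => termCode (ts i))) + 2
  | _, .imp φ ψ => 4 * Nat.pair (formulaCode φ) (formulaCode ψ) + 3
  | _, .all φ => 4 * formulaCode φ + 4

/-- The effective, injective coding of sentences by natural numbers. -/
def sentenceCode (φ : Sentence) : ℕ := formulaCode φ

/-! ### Databases -/

/-- A ground atom `P(c₁, …, cₙ)` with constants from `Δ`, other than an equality. -/
@[ext]
structure Fact where
  arity : ℕ
  pred : vocab.Relations arity
  args : Fin arity → Const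

/-- `P(c₁, …, cₙ) ↦ P(τ(c₁), …, τ(cₙ))`. -/
def Fact.rename (τ : Const ↪ Const) (α : Fact) : Fact := ⟨α.arity, α.pred, fun i => τ (α.args i)⟩

theorem Fact.rename_injective (τ : Const ↪ Const) : Function.Injective (Fact.rename τ) := by
  rintro ⟨n, P, a⟩ ⟨m, R, b⟩ h
  simp only [Fact.rename, Fact.mk.injEq] at h
  obtain ⟨rfl, hP, hab⟩ := h
  subst hP
  have : a = b := funext fun i => τ.injective (congrFun (eq_of_heq hab) i)
  rw [this]

def Fact.code (α : Fact) : ℕ :=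
  Nat.pair (Nat.pair α.arity (Encodable.encode α.pred)) (Encodable.encode (List.ofFn α.args))

/-- A `σ`-database: a partial function from the facts over `σ` to `{1, 0, -1}`
(`none` meaning undefined). A fact is observed if its value is `1` (true) or `0` (false). The value
`-1` means that the atom was not observed but is settled by the closed-world assumption, so it is
taken only at atoms with a CWA-predicate symbol. -/
structure Database (σ : Signature) where
  val : Fact → Option SignType
  isOver : ∀ α, val α ≠ none → α.pred ∈ σ.preds α.arity
  finite_observed : {α | val α = some 1 ∨ val α = some 0}.Finite
  cwa_complete : ∀ α, α.pred ∈ σ.preds α.arity → IsCWA α.pred → val α ≠ none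
  neg_one_cwa : ∀ α, val α = some (-1) → IsCWA α.pred

namespace Database

variable {σ : Signature}

/-- No fact is observed to be false. -/
def IsPositive (D : Database σ) : Prop := ∀ α, D.val α ≠ some 0

/-- `D₀` extends `D` as a partial function. -/
def Extends (D₀ D : Database σ) : Prop := ∀ α v, D.val α = some v → D₀.val α = some v

open Classical in
/-- The database `τ(D)`: the value of `τ(α)` in it is that of `α` in `D`, and an atom that is not of
the form `τ(α)` is unobserved, so that it has value `-1` if its predicate symbol is a CWA-predicate
symbol of `σ`, and no value otherwise. -/
def rename (τ : Const ↪ Const) (D : Database σ) : Database σ where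
  val := Function.extend (Fact.rename τ) D.val
    fun β => if β.pred ∈ σ.preds β.arity ∧ IsCWA β.pred then some (-1) else none
  isOver β h := by
    by_cases hβ : ∃ α, Fact.rename τ α = β
    · obtain ⟨α, rfl⟩ := hβ
      rw [(Fact.rename_injective τ).extend_apply] at h
      exact D.isOver α h
    · rw [Function.extend_apply' _ _ _ hβ] at h
      by_contra hc
      exact h (if_neg fun h' => hc h'.1)
  finite_observed := by
    refine (D.finite_observed.image (Fact.rename τ)).subset ?_
    intro β h
    by_cases hβ : ∃ α, Fact.rename τ α = β
    · obtain ⟨α, rfl⟩ := hβ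
      rw [Set.mem_ofPred_eq, (Fact.rename_injective τ).extend_apply] at h
      exact ⟨α, h, rfl⟩
    · rw [Set.mem_ofPred_eq, Function.extend_apply' _ _ _ hβ] at h
      split_ifs at h <;> simp at h
  cwa_complete β h₁ h₂ := by
    by_cases hβ : ∃ α, Fact.rename τ α = β
    · obtain ⟨α, rfl⟩ := hβ
      rw [(Fact.rename_injective τ).extend_apply]
      exact D.cwa_complete α h₁ h₂
    · rw [Function.extend_apply' _ _ _ hβ, if_pos ⟨h₁, h₂⟩]
      simp
  neg_one_cwa β h := by
    by_cases hβ : ∃ α, Fact.rename τ α = β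
    · obtain ⟨α, rfl⟩ := hβ
      rw [(Fact.rename_injective τ).extend_apply] at h
      exact D.neg_one_cwa α h
    · rw [Function.extend_apply' _ _ _ hβ] at h
      by_contra hc
      rw [if_neg fun h' => hc h'.2] at h
      simp at h

/-- The effective, injective coding of databases by natural numbers: the code of the increasing list
of the codes of the observed facts, each together with its truth value. -/
def code (D : Database σ) : ℕ :=
  Encodable.encode <| Finset.sort <| D.finite_observed.toFinset.image
    fun α => Nat.pair α.code (if D.val α = some 1 then 1 else 0)

end Database

/-- The class of all `σ`-databases. -/
def allDatabases (σ : Signature) : Set (Database σ) := Set.univ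

/-- The class of positive `σ`-databases. -/
def positiveDatabases (σ : Signature) : Set (Database σ) := {D | D.IsPositive}

/-! ### Query languages and knowledge bases -/

/-- `𝒬` is a query language of the query signature `σ`. -/
structure IsQueryLanguage (σ : Signature) (𝒬 : Set Sentence) : Prop where
  isOver : ∀ φ ∈ 𝒬, FormulaOver σ φ
  recursive : ComputablePred fun n : ℕ => ∃ φ ∈ 𝒬, sentenceCode φ = n
  conj : ∀ φ ∈ 𝒬, ∀ ψ ∈ 𝒬, φ ⊓ ψ ∈ 𝒬
  rename : ∀ (τ : Const ↪ Const), ∀ φ ∈ 𝒬, renameSentence τ φ ∈ 𝒬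
  exists_not_tautology : ∃ φ ∈ 𝒬, ¬ IsTautology φ

variable {σ : Signature}

/-- `K` is a knowledge base over `(𝒟, 𝒬)`. -/
structure IsKB (𝒟 : Set (Database σ)) (𝒬 : Set Sentence) (K : Set (Database σ × Sentence)) :
    Prop where
  subset : K ⊆ 𝒟 ×ˢ 𝒬
  tautology : ∀ D ∈ 𝒟, ∀ φ ∈ 𝒬, IsTautology φ → (D, φ) ∈ K
  implication : ∀ D φ, (D, φ) ∈ K → ∀ ψ ∈ 𝒬, Entails φ ψ → (D, ψ) ∈ K
  conj : ∀ D φ ψ, (D, φ) ∈ K → (D, ψ) ∈ K → (D, φ ⊓ ψ) ∈ K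
  extension : ∀ D φ, (D, φ) ∈ K → ∀ D₀ ∈ 𝒟, D₀.Extends D → (D₀, φ) ∈ K
  rename : ∀ D φ, (D, φ) ∈ K → ∀ τ : Const ↪ Const, (D.rename τ, renameSentence τ φ) ∈ K

/-! ### Knowledge representation formalisms -/

/-- A partial function assigning a class of database-query pairs to binary strings. -/
abbrev Formalism (σ : Signature) : Type := List Bool →. Set (Database σ × Sentence)

/-- `Γ` is a quasi knowledge representation formalism over `(𝒟, 𝒬)`. -/
structure IsQKRF (𝒟 : Set (Database σ)) (𝒬 : Set Sentence) (Γ : Formalism σ) : Prop where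
  dom_recursive : ComputablePred fun π => π ∈ Γ.Dom
  isKB : ∀ π, ∀ K ∈ Γ π, IsKB 𝒟 𝒬 K

/-- `Γ` is a knowledge representation formalism over `(𝒟, 𝒬)`: moreover, some machine, given
`π ∈ dom(Γ)`, `D ∈ 𝒟` and `φ ∈ 𝒬`, accepts if and only if `(D, φ) ∈ Γ(π)`. -/
structure IsKRF (𝒟 : Set (Database σ)) (𝒬 : Set Sentence) (Γ : Formalism σ) : Prop
    extends IsQKRF 𝒟 𝒬 Γ where
  re : ∃ R : List Bool × ℕ × ℕ → Prop, REPred R ∧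
    ∀ π, ∀ K ∈ Γ π, ∀ D ∈ 𝒟, ∀ φ ∈ 𝒬, (R (π, D.code, sentenceCode φ) ↔ (D, φ) ∈ K)

/-- A partial function on binary strings is recursive if it is partial recursive and its domain is
recursive. -/
def IsRecursive (p : List Bool →. List Bool) : Prop :=
  Partrec p ∧ ComputablePred fun π => π ∈ p.Dom

/-- `p` is a reduction from `Γ` to `Γ₀`: a recursive function from `dom(Γ)` to `dom(Γ₀)` with
`Γ = Γ₀ ∘ p`. -/
structure IsReduction (Γ Γ₀ : Formalism σ) (p : List Bool →. List Bool) : Prop where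
  recursive : IsRecursive p
  dom_eq : p.Dom = Γ.Dom
  ran_subset : p.ran ⊆ Γ₀.Dom
  comp_eq : Γ = Γ₀.comp p

def Reducible (Γ Γ₀ : Formalism σ) : Prop := ∃ p, IsReduction Γ Γ₀ p

/-- `Γ` is a universal KRF over `(𝒟, 𝒬)`. -/
def IsUniversalKRF (𝒟 : Set (Database σ)) (𝒬 : Set Sentence) (Γ : Formalism σ) : Prop :=
  IsKRF 𝒟 𝒬 Γ ∧ ∀ Γ' : Formalism σ, IsKRF 𝒟 𝒬 Γ' → Reducible Γ' Γ

/-- There is a recursive bijection `p` from `dom(Γ)` to `dom(Γ₀)` with `Γ = Γ₀ ∘ p`. -/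
def RecursivelyIsomorphic (Γ Γ₀ : Formalism σ) : Prop :=
  ∃ p, IsReduction Γ Γ₀ p ∧ (∀ π π' ω, ω ∈ p π → ω ∈ p π' → π = π') ∧ p.ran = Γ₀.Dom

/-! ### The canonical formalism -/

/-- `cl(K)`, the least class that contains `K` and is a knowledge base over `(𝒟, 𝒬)`. -/
def closure (𝒟 : Set (Database σ)) (𝒬 : Set Sentence) (K : Set (Database σ × Sentence)) :
    Set (Database σ × Sentence) :=
  ⋂₀ {K' | IsKB 𝒟 𝒬 K' ∧ K ⊆ K'}

/-- `𝕂(M)`, the class of all `(D, φ) ∈ 𝒟 × 𝒬` such that `M` accepts (the code of) `(D, φ)`. Machines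
are represented by Mathlib's programs for partial recursive functions; accepting means halting. -/
def accepted (𝒟 : Set (Database σ)) (𝒬 : Set Sentence) (M : Nat.Partrec.Code) :
    Set (Database σ × Sentence) :=
  {x | x ∈ 𝒟 ×ˢ 𝒬 ∧ (M.eval (Nat.pair x.1.code (sentenceCode x.2))).Dom}

/-- The binary string that describes `M` (the binary digits of its number). -/
def machineString (M : Nat.Partrec.Code) : List Bool := (Encodable.encode M).bits

/-- The canonical formalism `Θ`. Its theories are the descriptions of the machines `M*` that enumerate
the closure of what `M` accepts; `M*` is determined by `M`, it is described by the string of `M`, and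
the class of pairs that it accepts is `cl(𝕂(M))`. -/
def Theta (𝒟 : Set (Database σ)) (𝒬 : Set Sentence) : Formalism σ := fun π =>
  ⟨∃ M, machineString M = π, fun h => closure 𝒟 𝒬 (accepted 𝒟 𝒬 h.choose)⟩

end

end KRF

/-!
Two facts carry the theorem: the canonical formalism `Θ` is a universal KRF, and universal KRFs
admit padding, so that an effective back-and-forth construction applies.

*`Θ` is a KRF.* The closure of a set `K` of pairs is obtained in one step: `(D, φ)` belongs to it
iff there are finitely many `(Dᵢ, φᵢ) ∈ K` and injections `τᵢ` such that `D` extends `τᵢ(Dᵢ)` and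
the sentences `τᵢ(φᵢ)` entail `φ` (`closure_eq_followsFrom`). Only finitely many constants matter,
so the `τᵢ` may be taken to be finite permutations, which have codes. The relation that `D` extends
`τ(D')` is primitive recursive in codes (`ExtendsCode`), and it forces a number to be the code of
a database in the given class, so nothing about the signature has to be decided. It remains to see
that logical consequence is recursively enumerable. In place of a proof calculus, truth in a
structure is described by countably many propositional clauses, which express Tarski's definition
of satisfaction over a set of formal points with Henkin witnesses. Valuations that satisfy the
clauses correspond to structures, and compactness of propositional logic makes unsatisfiability a
matter of finite search (`refuted_entailmentLits_iff`). Altogether, membership in the closure has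
finite certificates (`exists_isCertificate_iff`).

*`Θ` is universal.* A program that accepts the members of `Γ(π)`, with `π` as a parameter, yields by
the s-m-n theorem a program for each single `Γ(π)`, and `Γ(π)` is its own closure
(`isUniversalKRF_theta`).

*Padding.* Given a theory and a finite list `S` of theories of the same meaning, a further theory
of that meaning is computed as follows (`IsUniversalKRF.exists_pad`). By the recursion theorem
there is a program that imitates the given theory, unless its own translation is in `S`, in which
case it accepts nothing; and another one which in this case accepts everything. Both cannot be
caught in `S`, because the least knowledge base differs from the greatest one: some query is not a
tautology.

*Back and forth.* Padding makes translations between universal formalisms avoid any finite list,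
and `recursivelyIsomorphic_of_fresh` builds a recursive bijection as the union of a computable
chain of finite partial injections that preserve meaning.
-/

namespace KRF

/-! ### Numeric codes: lists, finite permutations, renamed function symbols -/

/-- The list of natural numbers with code `n`. -/
@[irreducible] def codedList (n : ℕ) : List ℕ := Denumerable.ofNat (List ℕ) n

/-- The list of pairs of natural numbers with code `n`. -/
@[irreducible] def codedPairs (n : ℕ) : List (ℕ × ℕ) := Denumerable.ofNat (List (ℕ × ℕ)) n

@[simp] theorem codedList_encode (l : List ℕ) : codedList (Encodable.encode l) = l := by
  rw [codedList, Denumerable.ofNat_encode]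

@[simp] theorem encode_codedList (n : ℕ) : Encodable.encode (codedList n) = n := by
  rw [codedList, Denumerable.encode_ofNat]

@[simp] theorem codedList_zero : codedList 0 = [] := by
  rw [codedList, Denumerable.list_ofNat_zero]

@[simp] theorem codedPairs_encode (l : List (ℕ × ℕ)) : codedPairs (Encodable.encode l) = l := by
  rw [codedPairs, Denumerable.ofNat_encode]

@[simp] theorem codedPairs_zero : codedPairs 0 = [] := by
  rw [codedPairs, Denumerable.list_ofNat_zero]

theorem lt_of_mem_codedList {x n : ℕ} (h : x ∈ codedList n) : x < n := by
  obtain ⟨l, rfl⟩ : ∃ l : List ℕ, n = Encodable.encode l :=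
    ⟨codedList n, (encode_codedList n).symm⟩
  rw [codedList_encode] at h
  induction l with
  | nil => simp at h
  | cons a l ih =>
    rw [Encodable.encode_list_cons]
    rcases List.mem_cons.1 h with rfl | h
    · exact Nat.lt_succ_of_le (Nat.left_le_pair _ _)
    · exact (ih h).trans (Nat.lt_succ_of_le (Nat.right_le_pair _ _))

/-- The finite permutation of `ℕ` that is the product of a list of transpositions. -/
def swapsPerm (l : List (ℕ × ℕ)) : Equiv.Perm ℕ := (l.map fun ab => Equiv.swap ab.1 ab.2).prod

/-- The finite permutation with code `r`: a code of a list of transpositions. -/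
def codedPerm (r : ℕ) : Equiv.Perm ℕ := swapsPerm (codedPairs r)

theorem codedPerm_zero : codedPerm 0 = 1 := by
  rw [codedPerm, codedPairs_zero]; rfl

/-- Every permutation agrees with a coded one on any given initial segment; this holds for
injections as well. -/
theorem exists_codedPerm_eqOn (τ : ℕ ↪ ℕ) (N : ℕ) : ∃ r, ∀ c < N, codedPerm r c = τ c := by
  suffices ∃ l, ∀ c < N, swapsPerm l c = τ c by
    obtain ⟨l, hl⟩ := this
    exact ⟨Encodable.encode l, by simpa [codedPerm] using hl⟩
  induction N with
  | zero => exact ⟨[], by simp⟩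
  | succ N ih =>
    obtain ⟨l, hl⟩ := ih
    refine ⟨(swapsPerm l N, τ N) :: l, fun c hc => ?_⟩
    have : swapsPerm ((swapsPerm l N, τ N) :: l) c
        = Equiv.swap (swapsPerm l N) (τ N) (swapsPerm l c) := by simp [swapsPerm]
    rw [this]
    rcases Nat.lt_succ_iff_lt_or_eq.1 hc with hc | rfl
    · rw [hl c hc]
      refine Equiv.swap_apply_of_ne_of_ne ?_ fun h => hc.ne (τ.injective h)
      rw [← hl c hc]
      exact fun h => hc.ne ((swapsPerm l).injective h)
    · exact Equiv.swap_apply_left _ _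

/-- The renaming of constants `r`, acting on the codes `Nat.pair k f` of function symbols. -/
def renameSymbol (r f : ℕ) : ℕ :=
  if f.unpair.1 = 0 then Nat.pair 0 (codedPerm r f.unpair.2) else f

/-! ### Satisfaction for arbitrary numbers -/

section Raw

variable {M : Type} (I : ℕ → List M → M) (R : ℕ → List M → Prop) (d : M) (r : ℕ)

/-- The value of the term with code `t` after renaming its constants by `r`, under the assignment
`env`. Every number is read as the code of a term, with `d` as default value of variables. -/
def rawTerm (env : List M) (t : ℕ) : M :=
  if t % 2 = 0 then env.getD (t / 2) d
  else I (renameSymbol r (t / 2).unpair.1)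
    ((codedList (t / 2).unpair.2).attach.map fun x => rawTerm env x.1)
termination_by t
decreasing_by
  have h₁ := lt_of_mem_codedList x.2
  have h₂ := Nat.unpair_right_le (t / 2)
  omega

theorem rawTerm_var (env : List M) (i : ℕ) : rawTerm I d r env (2 * i) = env.getD i d := by
  rw [rawTerm]; simp

theorem rawTerm_func (env : List M) (f ts : ℕ) :
    rawTerm I d r env (2 * Nat.pair f ts + 1) =
      I (renameSymbol r f) ((codedList ts).map (rawTerm I d r env)) := by
  rw [rawTerm, if_neg (by omega), show (2 * Nat.pair f ts + 1) / 2 = Nat.pair f ts by omega]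
  rw [List.attach_map_val (f := rawTerm I d r env), Nat.unpair_pair]

/-- Satisfaction of the formula with code `m` after renaming its constants by `r`, under the
assignment `env`; every number is read as the code of a formula. -/
def rawSat (m : ℕ) (env : List M) : Prop :=
  if m = 0 then False
  else if (m - 1) % 4 = 0 then
    rawTerm I d r env ((m - 1) / 4).unpair.1 = rawTerm I d r env ((m - 1) / 4).unpair.2
  else if (m - 1) % 4 = 1 then
    R ((m - 1) / 4).unpair.1 ((codedList ((m - 1) / 4).unpair.2).map (rawTerm I d r env))
  else if (m - 1) % 4 = 2 then
    rawSat ((m - 1) / 4).unpair.1 env → rawSat ((m - 1) / 4).unpair.2 env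
  else ∀ x, rawSat ((m - 1) / 4) (env ++ [x])
termination_by m
decreasing_by
  · have := Nat.unpair_left_le ((m - 1) / 4); omega
  · have := Nat.unpair_right_le ((m - 1) / 4); omega
  · omega

theorem rawSat_zero (env : List M) : ¬ rawSat I R d r 0 env := by rw [rawSat]; simp

theorem rawSat_equal (env : List M) (t u : ℕ) :
    rawSat I R d r (4 * Nat.pair t u + 1) env ↔ rawTerm I d r env t = rawTerm I d r env u := by
  rw [rawSat]; simp

theorem rawSat_rel (env : List M) (P ts : ℕ) :
    rawSat I R d r (4 * Nat.pair P ts + 2) env ↔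
      R P ((codedList ts).map (rawTerm I d r env)) := by
  rw [rawSat, if_neg (by omega), if_neg (by omega), if_pos (by omega),
    show (4 * Nat.pair P ts + 2 - 1) / 4 = Nat.pair P ts by omega, Nat.unpair_pair]

theorem rawSat_imp (env : List M) (a b : ℕ) :
    rawSat I R d r (4 * Nat.pair a b + 3) env ↔ (rawSat I R d r a env → rawSat I R d r b env) := by
  rw [rawSat, if_neg (by omega), if_neg (by omega), if_neg (by omega), if_pos (by omega),
    show (4 * Nat.pair a b + 3 - 1) / 4 = Nat.pair a b by omega, Nat.unpair_pair]

theorem rawSat_all (env : List M) (a : ℕ) :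
    rawSat I R d r (4 * a + 4) env ↔ ∀ x, rawSat I R d r a (env ++ [x]) := by
  rw [rawSat, if_neg (by omega), if_neg (by omega), if_neg (by omega), if_neg (by omega),
    show (4 * a + 4 - 1) / 4 = a by omega]

end Raw

section Structure

open FirstOrder FirstOrder.Language

variable {M : Type} [vocab.Structure M] (d : M)

/-- The interpretation of coded function symbols in a structure; argument lists are cut or padded
with `d` to the right length. -/
def rawFun (f : ℕ) (l : List M) : M :=
  Structure.funMap (L := vocab) (n := f.unpair.1) (f.unpair.2 : ℕ) fun i => l.getD i d

/-- The interpretation of coded predicate symbols in a structure. -/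
def rawRel (P : ℕ) (l : List M) : Prop :=
  Structure.RelMap (L := vocab) (n := P.unpair.1) (Denumerable.ofNat (ℕ ⊕ ℕ) P.unpair.2)
    fun i => l.getD i d

theorem renameSymbol_pair (r k : ℕ) (f : vocab.Functions k) :
    renameSymbol r (Nat.pair k f) =
      Nat.pair k ((renameHom (codedPerm r).toEmbedding).onFunction f : vocab.Functions k) := by
  cases k <;> simp [renameSymbol, renameHom]

theorem rawFun_pair {k : ℕ} (f : vocab.Functions k) (xs : Fin k → M) :
    rawFun d (Nat.pair k f) (List.ofFn xs) = Structure.funMap f xs := by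
  unfold rawFun
  have : ∀ p : ℕ × ℕ, p = (k, f) → Structure.funMap (L := vocab) (M := M) (n := p.1) (p.2 : ℕ)
      (fun i => (List.ofFn xs).getD i d) = Structure.funMap f xs := by
    rintro _ rfl
    congr 1
    funext i
    simp [List.getD]
  exact this _ (Nat.unpair_pair _ _)

theorem rawRel_pair {k : ℕ} (P : vocab.Relations k) (xs : Fin k → M) :
    rawRel d (Nat.pair k (Encodable.encode P)) (List.ofFn xs) ↔ Structure.RelMap P xs := by
  unfold rawRel
  have : ∀ p : ℕ × ℕ, p = (k, Encodable.encode P) →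
      (Structure.RelMap (L := vocab) (M := M) (n := p.1) (Denumerable.ofNat (ℕ ⊕ ℕ) p.2)
      (fun i => (List.ofFn xs).getD i d) ↔ Structure.RelMap P xs) := by
    rintro _ rfl
    rw [Denumerable.ofNat_encode (α := ℕ ⊕ ℕ) P]
    have : (fun i : Fin k => (List.ofFn xs).getD i d) = xs := by
      funext i
      simp [List.getD]
    rw [this]
  exact this _ (Nat.unpair_pair _ _)

theorem rawTerm_termCode (r : ℕ) {n : ℕ} (xs : Fin n → M) (t : vocab.Term (Empty ⊕ Fin n)) :
    rawTerm (rawFun d) d r (List.ofFn xs) (termCode t) =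
      ((renameHom (codedPerm r).toEmbedding).onTerm t).realize (Sum.elim default xs) := by
  induction t with
  | var i =>
    rcases i with e | i
    · exact e.elim
    · simp [termCode, rawTerm_var, LHom.onTerm, List.getD]
  | func f ts ih =>
    rw [termCode, rawTerm_func, codedList_encode, List.map_ofFn,
      renameSymbol_pair, rawFun_pair]
    simp only [LHom.onTerm, Term.realize]
    congr 1
    funext i
    exact ih i

theorem rawSat_formulaCode (r : ℕ) {n : ℕ} (φ : vocab.BoundedFormula Empty n) (xs : Fin n → M) :
    rawSat (rawFun d) (rawRel d) d r (formulaCode φ) (List.ofFn xs) ↔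
      ((renameHom (codedPerm r).toEmbedding).onBoundedFormula φ).Realize default xs := by
  induction φ with
  | falsum => simp [formulaCode, rawSat_zero, LHom.onBoundedFormula, BoundedFormula.Realize]
  | equal t u =>
    rw [formulaCode, rawSat_equal, rawTerm_termCode, rawTerm_termCode]
    rfl
  | rel P ts =>
    rw [formulaCode, rawSat_rel, codedList_encode, List.map_ofFn, rawRel_pair]
    simp only [Function.comp_def, rawTerm_termCode]
    rfl
  | imp φ ψ ih₁ ih₂ =>
    rw [formulaCode, rawSat_imp, ih₁, ih₂]
    rfl
  | all φ ih =>
    rw [formulaCode, rawSat_all]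
    refine forall_congr' fun x => ?_
    rw [← ih, Fin.snoc_eq_append, List.ofFn_fin_append]
    simp

end Structure

/-! ### Propositional refutations -/

/-- Propositional literals: an atom together with the truth value that it asserts. -/
abbrev Lit : Type := ℕ × Bool

/-- The literal is true under the valuation `v`. -/
def Lit.Holds (v : ℕ → Prop) (x : Lit) : Prop := v x.1 ↔ x.2 = true

/-- The literal is false under the valuation of the atoms below `n` by the binary digits of `j`. -/
def Lit.FalseAt (n j : ℕ) (x : Lit) : Prop := x.1 < n ∧ j / 2 ^ x.1 % 2 ≠ x.2.toNat

/-- Each valuation of the atoms below `n` falsifies a literal of `s` or a clause in the first `n`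
members of the family `C`. -/
def RefutedAt (n : ℕ) (C : ℕ → List (List Lit)) (s : List Lit) : Prop :=
  ∀ j < 2 ^ n, (∃ x ∈ s, x.FalseAt n j) ∨ ∃ k < n, ∃ c ∈ C k, ∀ x ∈ c, x.FalseAt n j

/-- A finite number witnesses that no valuation satisfies the literals `s` and all clauses. -/
def Refuted (C : ℕ → List (List Lit)) (s : List Lit) : Prop := ∃ n, RefutedAt n C s

/-- Compactness of propositional logic. A satisfying valuation is obtained as a limit along an
ultrafilter of valuations that are good up to `n`. -/
theorem refuted_iff (C : ℕ → List (List Lit)) (s : List Lit) :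
    Refuted C s ↔ ¬ ∃ v : ℕ → Prop, (∀ x ∈ s, x.Holds v) ∧ ∀ k, ∀ c ∈ C k, ∃ x ∈ c, x.Holds v := by
  constructor
  · rintro ⟨n, hn⟩ ⟨v, hs, hC⟩
    classical
    have key : ∀ x : Lit, x.Holds v →
        ¬ x.FalseAt n (Nat.ofBits fun i : Fin n => decide (v i)) := by
      rintro ⟨a, b⟩ h ⟨ha, h'⟩
      have h₁ := Nat.testBit_ofBits_lt (fun i : Fin n => decide (v i)) a ha
      rw [Nat.testBit_eq_decide_div_mod_eq] at h₁
      simp only [Lit.Holds] at h ha h'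
      have := Nat.mod_two_eq_zero_or_one ((Nat.ofBits fun i : Fin n => decide (v i)) / 2 ^ a)
      cases b <;> simp_all
    rcases hn _ (Nat.ofBits_lt_two_pow _) with ⟨x, hx, h⟩ | ⟨k, -, c, hc, h⟩
    · exact key x (hs x hx) h
    · obtain ⟨x, hx, hv⟩ := hC k c hc
      exact key x hv (h x hx)
  · intro h
    by_contra hr
    simp only [Refuted, RefutedAt, not_exists, not_forall] at hr
    choose j hj hr using hr
    simp only [not_or, not_exists, not_and] at hr
    let U : Ultrafilter ℕ := Filter.hyperfilter ℕ
    have large : ∀ m : ℕ, ∀ᶠ n in (U : Filter ℕ), m < n := fun m =>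
      Nat.hyperfilter_le_atTop (Filter.eventually_gt_atTop m)
    let v : ℕ → Prop := fun a => ∀ᶠ n in (U : Filter ℕ), j n / 2 ^ a % 2 = 1
    have key : ∀ x : Lit, ¬ x.Holds v → ∀ᶠ n in (U : Filter ℕ), x.FalseAt n (j n) := by
      rintro ⟨a, b⟩ hx
      cases b with
      | true =>
        have hx : ¬ v a := by simpa [Lit.Holds] using hx
        filter_upwards [Ultrafilter.eventually_not.2 hx, large a] with n h₁ h₂
        exact ⟨h₂, by simpa using h₁⟩
      | false =>
        have hx : v a := by simpa [Lit.Holds] using hx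
        filter_upwards [hx, large a] with n h₁ h₂
        exact ⟨h₂, by simp [h₁]⟩
    have all : ∀ c : List Lit, (∀ x ∈ c, ¬ x.Holds v) →
        ∀ᶠ n in (U : Filter ℕ), ∀ x ∈ c, x.FalseAt n (j n) := by
      intro c
      induction c with
      | nil => simp
      | cons y c ih =>
        intro hc
        filter_upwards [key y (hc y (by simp)), ih fun x hx => hc x (by simp [hx])] with n h₁ h₂
        exact List.forall_mem_cons.2 ⟨h₁, h₂⟩
    refine h ⟨v, fun x hx => ?_, fun k c hc => ?_⟩
    · by_contra hv
      obtain ⟨n, hn⟩ := (key x hv).exists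
      exact (hr n).1 x hx hn
    · by_contra! hv
      obtain ⟨n, h₁, h₂⟩ := ((all c hv).and (large k)).exists
      exact (hr n).2 k h₂ c hc h₁

/-! ### The clauses of first-order satisfaction -/

/-- The atom stating that two points are equal. -/
def eqAtom (p q : ℕ) : ℕ := Nat.pair 0 (Nat.pair p q)

/-- The atom stating that the predicate symbol with code `P` holds of a list of points. -/
def relAtom (P : ℕ) (xs : List ℕ) : ℕ := Nat.pair 1 (Nat.pair P (Encodable.encode xs))

/-- The atom stating that the formula with code `m`, with constants renamed by `r`, holds under the
assignment with code `e` (a list of points). -/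
def satAtom (m r e : ℕ) : ℕ := Nat.pair 2 (Nat.pair m (Nat.pair r e))

/-- The point that is the value of the term with code `t`, with constants renamed by `r`, under the
assignment with code `e`. -/
def termPoint (r e t : ℕ) : ℕ := Nat.pair 0 (Nat.pair t (Nat.pair r e))

/-- The point that is the value of the function symbol with code `f` at a list of points. -/
def funPoint (f : ℕ) (xs : List ℕ) : ℕ := Nat.pair 1 (Nat.pair f (Encodable.encode xs))

/-- The Henkin witness: a counterexample to `∀ x, a(e, x)` if there is one. -/
def witPoint (a r e : ℕ) : ℕ := Nat.pair 2 (Nat.pair a (Nat.pair r e))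

/-- The clauses, with parameters `x, y, r, e`, which say that equality is a congruence, that terms
are evaluated according to their structure, and that formulas are satisfied according to Tarski's
definition, where the universal quantifier ranges over all points and has Henkin witnesses. -/
def tarskiClauses (x y r e : ℕ) : List (List Lit) :=
  [ [(eqAtom x x, true)],
    [(eqAtom x y, false), (eqAtom y x, true)],
    [(eqAtom x y, false), (eqAtom y r, false), (eqAtom x r, true)],
    (eqAtom (funPoint x ((codedPairs y).map Prod.fst))
        (funPoint x ((codedPairs y).map Prod.snd)), true) ::
      (codedPairs y).map fun z => (eqAtom z.1 z.2, false),
    (relAtom x ((codedPairs y).map Prod.fst), false) ::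
      (relAtom x ((codedPairs y).map Prod.snd), true) ::
      (codedPairs y).map fun z => (eqAtom z.1 z.2, false),
    [(eqAtom (termPoint r e (2 * x)) ((codedList e).getD x 0), true)],
    [(eqAtom (termPoint r e (2 * Nat.pair x y + 1))
        (funPoint (renameSymbol r x) ((codedList y).map (termPoint r e))), true)],
    [(satAtom 0 r e, false)],
    [(satAtom (4 * Nat.pair x y + 1) r e, false),
      (eqAtom (termPoint r e x) (termPoint r e y), true)],
    [(satAtom (4 * Nat.pair x y + 1) r e, true),
      (eqAtom (termPoint r e x) (termPoint r e y), false)],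
    [(satAtom (4 * Nat.pair x y + 2) r e, false),
      (relAtom x ((codedList y).map (termPoint r e)), true)],
    [(satAtom (4 * Nat.pair x y + 2) r e, true),
      (relAtom x ((codedList y).map (termPoint r e)), false)],
    [(satAtom (4 * Nat.pair x y + 3) r e, false), (satAtom x r e, false), (satAtom y r e, true)],
    [(satAtom (4 * Nat.pair x y + 3) r e, true), (satAtom x r e, true)],
    [(satAtom (4 * Nat.pair x y + 3) r e, true), (satAtom y r e, false)],
    [(satAtom (4 * x + 4) r e, false), (satAtom x r (Encodable.encode (codedList e ++ [y])), true)],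
    [(satAtom (4 * x + 4) r e, true),
      (satAtom x r (Encodable.encode (codedList e ++ [witPoint x r e])), false)] ]

/-- All the clauses, as a family indexed by numbers. -/
def tarskiFamily (k : ℕ) : List (List Lit) :=
  let p := Denumerable.ofNat (ℕ × ℕ × ℕ × ℕ) k
  tarskiClauses p.1 p.2.1 p.2.2.1 p.2.2.2

theorem forall_tarskiFamily {p : List Lit → Prop} :
    (∀ k, ∀ c ∈ tarskiFamily k, p c) ↔ ∀ x y r e, ∀ c ∈ tarskiClauses x y r e, p c := by
  constructor
  · intro h x y r e
    have := h (Encodable.encode (x, y, r, e))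
    simp only [tarskiFamily, Denumerable.ofNat_encode] at this
    exact this
  · exact fun h k => h _ _ _ _

theorem exists_holds_cons {v : ℕ → Prop} {a : ℕ} {b : Bool} {c : List Lit} :
    (∃ x ∈ (a, b) :: c, Lit.Holds v x) ↔ ((v a ↔ b = true) ∨ ∃ x ∈ c, Lit.Holds v x) := by
  simp only [List.mem_cons, exists_eq_or_imp]
  rfl

theorem exists_holds_map_false {v : ℕ → Prop} {l : List (ℕ × ℕ)} :
    (∃ x ∈ l.map (fun z => ((eqAtom z.1 z.2, false) : Lit)), Lit.Holds v x) ↔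
      ¬ ∀ z ∈ l, v (eqAtom z.1 z.2) := by
  simp [Lit.Holds]

/-- The conditions on a valuation that the clauses express. -/
theorem tarskiClauses_hold_iff (v : ℕ → Prop) (x y r e : ℕ) :
    (∀ c ∈ tarskiClauses x y r e, ∃ z ∈ c, Lit.Holds v z) ↔
      v (eqAtom x x) ∧ (v (eqAtom x y) → v (eqAtom y x)) ∧
      (v (eqAtom x y) → v (eqAtom y r) → v (eqAtom x r)) ∧
      ((∀ z ∈ codedPairs y, v (eqAtom z.1 z.2)) →
        v (eqAtom (funPoint x ((codedPairs y).map Prod.fst))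
          (funPoint x ((codedPairs y).map Prod.snd)))) ∧
      ((∀ z ∈ codedPairs y, v (eqAtom z.1 z.2)) →
        v (relAtom x ((codedPairs y).map Prod.fst)) →
          v (relAtom x ((codedPairs y).map Prod.snd))) ∧
      v (eqAtom (termPoint r e (2 * x)) ((codedList e).getD x 0)) ∧
      v (eqAtom (termPoint r e (2 * Nat.pair x y + 1))
        (funPoint (renameSymbol r x) ((codedList y).map (termPoint r e)))) ∧
      ¬ v (satAtom 0 r e) ∧
      (v (satAtom (4 * Nat.pair x y + 1) r e) ↔ v (eqAtom (termPoint r e x) (termPoint r e y))) ∧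
      (v (satAtom (4 * Nat.pair x y + 2) r e) ↔ v (relAtom x ((codedList y).map (termPoint r e)))) ∧
      (v (satAtom (4 * Nat.pair x y + 3) r e) ↔ (v (satAtom x r e) → v (satAtom y r e))) ∧
      (v (satAtom (4 * x + 4) r e) → v (satAtom x r (Encodable.encode (codedList e ++ [y])))) ∧
      (v (satAtom x r (Encodable.encode (codedList e ++ [witPoint x r e]))) →
        v (satAtom (4 * x + 4) r e)) := by
  simp only [tarskiClauses, List.forall_mem_cons, exists_holds_cons, exists_holds_map_false,
    List.not_mem_nil, false_and, exists_false, or_false, iff_true, Bool.false_eq_true, iff_false,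
    false_imp_iff, forall_const, and_true]
  have e₂ {a b c c' : Prop} (h : c ↔ c') :
      ((¬ a ∨ b) ∧ (a ∨ ¬ b) ∧ c) ↔ ((a ↔ b) ∧ c') := by rw [h]; tauto
  have e₃ {a b c d d' : Prop} (h : d ↔ d') :
      ((¬ a ∨ ¬ b ∨ c) ∧ (a ∨ b) ∧ (a ∨ ¬ c) ∧ d) ↔ ((a ↔ (b → c)) ∧ d') := by rw [h]; tauto
  have e₄ (a b c : Prop) : (a → b → c) ↔ (¬ a ∨ ¬ b ∨ c) := by tauto
  have e₅ (a b : Prop) : (a → b) ↔ (b ∨ ¬ a) := by tauto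
  have e₆ (a b c : Prop) : (a → b → c) ↔ (¬ b ∨ c ∨ ¬ a) := by tauto
  exact and_congr Iff.rfl <| and_congr imp_iff_not_or.symm <| and_congr (e₄ _ _ _).symm <|
    and_congr (e₅ _ _).symm <| and_congr (e₆ _ _ _).symm <| and_congr Iff.rfl <|
    and_congr Iff.rfl <| and_congr Iff.rfl <| e₂ <| e₂ <| e₃ <|
    and_congr imp_iff_not_or.symm (e₅ _ _).symm

open Classical in
/-- A counterexample to `∀ x, p x` if there is one, and `d` otherwise. -/
noncomputable def counterexample {M : Type} (p : M → Prop) (d : M) : M :=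
  if h : ∃ x, ¬ p x then h.choose else d

theorem forall_of_counterexample {M : Type} {p : M → Prop} {d : M} (h : p (counterexample p d))
    (x : M) : p x := by
  by_contra hx
  have h' : ∃ x, ¬ p x := ⟨x, hx⟩
  rw [counterexample, dif_pos h'] at h
  exact h'.choose_spec h

section Soundness

variable {M : Type} (I : ℕ → List M → M) (R : ℕ → List M → Prop) (d : M)

/-- The element of a structure that is denoted by a point. -/
noncomputable def pointValue (p : ℕ) : M :=
  if p.unpair.1 = 0 then
    rawTerm I d p.unpair.2.unpair.2.unpair.1
      ((codedList p.unpair.2.unpair.2.unpair.2).attach.map fun x => pointValue x.1)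
      p.unpair.2.unpair.1
  else if p.unpair.1 = 1 then
    I p.unpair.2.unpair.1
      ((codedList p.unpair.2.unpair.2).attach.map fun x => pointValue x.1)
  else
    counterexample (fun z => rawSat I R d p.unpair.2.unpair.2.unpair.1 p.unpair.2.unpair.1
      (((codedList p.unpair.2.unpair.2.unpair.2).attach.map fun x => pointValue x.1) ++ [z])) d
termination_by p
decreasing_by
  all_goals
    have h₁ := lt_of_mem_codedList x.2
    have h₂ := Nat.unpair_right_le p
    have h₃ := Nat.unpair_right_le p.unpair.2
    have h₄ := Nat.unpair_right_le p.unpair.2.unpair.2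
    omega

theorem pointValue_termPoint (r e t : ℕ) : pointValue I R d (termPoint r e t) =
    rawTerm I d r ((codedList e).map (pointValue I R d)) t := by
  rw [pointValue, termPoint, if_pos (by simp), List.attach_map_val (f := pointValue I R d)]
  simp

theorem pointValue_funPoint (f : ℕ) (xs : List ℕ) :
    pointValue I R d (funPoint f xs) = I f (xs.map (pointValue I R d)) := by
  rw [pointValue, funPoint, if_neg (by simp), if_pos (by simp),
    List.attach_map_val (f := pointValue I R d)]
  simp

theorem pointValue_zero : pointValue I R d 0 = d := by
  have := pointValue_termPoint I R d 0 0 0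
  rw [termPoint, show Nat.pair 0 (Nat.pair 0 (Nat.pair 0 0)) = 0 from rfl] at this
  rw [this, codedList_zero]
  exact rawTerm_var I d 0 [] 0

theorem rawSat_witPoint (a r e : ℕ)
    (h : rawSat I R d r a ((codedList e).map (pointValue I R d) ++
      [pointValue I R d (witPoint a r e)])) (x : M) :
    rawSat I R d r a ((codedList e).map (pointValue I R d) ++ [x]) := by
  have hw : pointValue I R d (witPoint a r e) = counterexample
      (fun z => rawSat I R d r a ((codedList e).map (pointValue I R d) ++ [z])) d := by
    rw [pointValue, witPoint, if_neg (by simp), if_neg (by simp),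
      List.attach_map_val (f := pointValue I R d)]
    simp only [Nat.unpair_pair]
  rw [hw] at h
  exact forall_of_counterexample
    (p := fun z => rawSat I R d r a ((codedList e).map (pointValue I R d) ++ [z])) h x

/-- The truth values of the atoms in a structure. -/
def atomTruth (a : ℕ) : Prop :=
  if a.unpair.1 = 0 then
    pointValue I R d a.unpair.2.unpair.1 = pointValue I R d a.unpair.2.unpair.2
  else if a.unpair.1 = 1 then
    R a.unpair.2.unpair.1 ((codedList a.unpair.2.unpair.2).map (pointValue I R d))
  else
    rawSat I R d a.unpair.2.unpair.2.unpair.1 a.unpair.2.unpair.1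
      ((codedList a.unpair.2.unpair.2.unpair.2).map (pointValue I R d))

theorem atomTruth_eqAtom (p q : ℕ) :
    atomTruth I R d (eqAtom p q) ↔ pointValue I R d p = pointValue I R d q := by
  simp [atomTruth, eqAtom]

theorem atomTruth_relAtom (P : ℕ) (xs : List ℕ) :
    atomTruth I R d (relAtom P xs) ↔ R P (xs.map (pointValue I R d)) := by
  simp [atomTruth, relAtom]

theorem atomTruth_satAtom (m r e : ℕ) :
    atomTruth I R d (satAtom m r e) ↔
      rawSat I R d r m ((codedList e).map (pointValue I R d)) := by
  simp [atomTruth, satAtom]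

/-- Soundness: every structure, with Henkin witnesses chosen in it, yields a valuation that
satisfies all clauses. -/
theorem atomTruth_tarskiClauses (x y r e : ℕ) :
    ∀ c ∈ tarskiClauses x y r e, ∃ z ∈ c, Lit.Holds (atomTruth I R d) z := by
  have hcongr : (∀ z ∈ codedPairs y, pointValue I R d z.1 = pointValue I R d z.2) →
      (((codedPairs y).map Prod.fst).map (pointValue I R d)) =
      (((codedPairs y).map Prod.snd).map (pointValue I R d)) := by
    intro h
    rw [List.map_map, List.map_map]
    exact List.map_congr_left h
  have hcomp : ((codedList y).map (termPoint r e)).map (pointValue I R d) =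
      (codedList y).map (rawTerm I d r ((codedList e).map (pointValue I R d))) := by
    rw [List.map_map]
    exact List.map_congr_left fun t _ => pointValue_termPoint I R d r e t
  have hget : pointValue I R d ((codedList e).getD x 0) =
      ((codedList e).map (pointValue I R d)).getD x d := by
    have := pointValue_zero I R d
    simp only [List.getD_eq_getElem?_getD, List.getElem?_map]
    cases (codedList e)[x]? <;> simp [this]
  rw [tarskiClauses_hold_iff]
  simp only [atomTruth_eqAtom, atomTruth_relAtom, atomTruth_satAtom, pointValue_termPoint,
    pointValue_funPoint, rawTerm_var, rawTerm_func, rawSat_zero, rawSat_equal, rawSat_rel,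
    rawSat_imp, rawSat_all, hcomp, hget, codedList_encode, List.map_append, List.map_cons,
    List.map_nil, not_false_eq_true, true_and, iff_self]
  refine ⟨Eq.symm, fun h₁ h₂ => h₁.trans h₂, fun h => by rw [hcongr h],
    fun h => by rw [hcongr h]; exact id, fun h => h _, rawSat_witPoint I R d x r e⟩

end Soundness

section CanonicalModel

open FirstOrder FirstOrder.Language

variable {v : ℕ → Prop} (hv : ∀ x y r e, ∀ c ∈ tarskiClauses x y r e, ∃ z ∈ c, Lit.Holds v z)

/-- Equality of points according to a valuation that satisfies the clauses. -/
def pointSetoid : Setoid ℕ where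
  r p q := v (eqAtom p q)
  iseqv := by
    have h := fun x y r e => (tarskiClauses_hold_iff v x y r e).1 (hv x y r e)
    exact ⟨fun x => (h x 0 0 0).1, fun {x y} => (h x y 0 0).2.1, fun {x y z} => (h x y z 0).2.2.1⟩

/-- The domain of the canonical model: the points modulo equality. -/
abbrev CanonicalModel : Type := Quotient (pointSetoid hv)

/-- Function symbols act by `funPoint` and predicate symbols by `relAtom`; the choice of
representatives is harmless by the congruence clauses, see `funMap_mk` and `relMap_mk`. -/
noncomputable instance canonicalStructure : vocab.Structure (CanonicalModel hv) where
  funMap {n} f xs := Quotient.mk (pointSetoid hv)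
    (funPoint (Nat.pair n f) (List.ofFn fun i => (xs i).out))
  RelMap {n} P xs :=
    v (relAtom (Nat.pair n (Encodable.encode P)) (List.ofFn fun i => (xs i).out))

theorem forall_mem_codedPairs_ofFn {n : ℕ} {a b : Fin n → ℕ} (h : ∀ i, v (eqAtom (a i) (b i))) :
    ∀ z ∈ codedPairs (Encodable.encode (List.ofFn fun i => (a i, b i))), v (eqAtom z.1 z.2) := by
  intro z hz
  rw [codedPairs_encode, List.mem_ofFn] at hz
  obtain ⟨i, rfl⟩ := hz
  exact h i

theorem funMap_mk {n : ℕ} (f : vocab.Functions n) (a : Fin n → ℕ) :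
    Structure.funMap f (fun i => (Quotient.mk (pointSetoid hv) (a i) : CanonicalModel hv)) =
      Quotient.mk (pointSetoid hv) (funPoint (Nat.pair n f) (List.ofFn a)) := by
  refine Quotient.sound (s := pointSetoid hv) ?_
  have h := ((tarskiClauses_hold_iff v (Nat.pair n f) (Encodable.encode (List.ofFn
    fun i => ((Quotient.mk (pointSetoid hv) (a i)).out, a i))) 0 0).1 (hv _ _ _ _)).2.2.2.1
    (forall_mem_codedPairs_ofFn fun i => Quotient.mk_out (s := pointSetoid hv) (a i))
  rw [codedPairs_encode, List.map_ofFn, List.map_ofFn] at h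
  exact h

theorem relMap_mk {n : ℕ} (P : vocab.Relations n) (a : Fin n → ℕ) :
    Structure.RelMap P (fun i => (Quotient.mk (pointSetoid hv) (a i) : CanonicalModel hv)) ↔
      v (relAtom (Nat.pair n (Encodable.encode P)) (List.ofFn a)) := by
  have key : ∀ b c : Fin n → ℕ, (∀ i, v (eqAtom (b i) (c i))) →
      v (relAtom (Nat.pair n (Encodable.encode P)) (List.ofFn b)) →
      v (relAtom (Nat.pair n (Encodable.encode P)) (List.ofFn c)) := by
    intro b c hbc
    have h := ((tarskiClauses_hold_iff v (Nat.pair n (Encodable.encode P)) (Encodable.encode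
      (List.ofFn fun i => (b i, c i))) 0 0).1 (hv _ _ _ _)).2.2.2.2.1
      (forall_mem_codedPairs_ofFn hbc)
    rw [codedPairs_encode, List.map_ofFn, List.map_ofFn] at h
    exact h
  have hout := fun i => Quotient.mk_out (s := pointSetoid hv) (a i)
  exact ⟨key _ _ hout, key _ _ fun i => (pointSetoid hv).symm (hout i)⟩

theorem mk_termPoint (r : ℕ) {n : ℕ} (p : Fin n → ℕ) (t : vocab.Term (Empty ⊕ Fin n)) :
    (Quotient.mk (pointSetoid hv)
      (termPoint r (Encodable.encode (List.ofFn p)) (termCode t)) : CanonicalModel hv) =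
      ((renameHom (codedPerm r).toEmbedding).onTerm t).realize
        (Sum.elim default fun i => Quotient.mk (pointSetoid hv) (p i)) := by
  induction t with
  | var i =>
    rcases i with e | i
    · exact e.elim
    · have h := ((tarskiClauses_hold_iff v i 0 r (Encodable.encode (List.ofFn p))).1
        (hv _ _ _ _)).2.2.2.2.2.1
      refine Quotient.sound (s := pointSetoid hv) ?_
      simp only [codedList_encode, List.getD, List.getElem?_ofFn, i.is_lt, dite_true,
        Option.getD_some] at h
      exact h
  | func f ts ih =>
    rename_i l
    have h := ((tarskiClauses_hold_iff v (Nat.pair l f) (Encodable.encode (List.ofFn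
      fun i => termCode (ts i))) r (Encodable.encode (List.ofFn p))).1 (hv _ _ _ _)).2.2.2.2.2.2.1
    rw [codedList_encode, List.map_ofFn, renameSymbol_pair] at h
    rw [termCode]
    refine (Quotient.sound (s := pointSetoid hv) h).trans ?_
    simp only [LHom.onTerm, Term.realize, ← ih]
    exact (funMap_mk hv _ _).symm

/-- The truth lemma: the satisfaction atoms describe satisfaction in the canonical model. -/
theorem satAtom_iff (r : ℕ) {n : ℕ} (φ : vocab.BoundedFormula Empty n) (p : Fin n → ℕ) :
    v (satAtom (formulaCode φ) r (Encodable.encode (List.ofFn p))) ↔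
      ((renameHom (codedPerm r).toEmbedding).onBoundedFormula φ).Realize
        default (fun i => (Quotient.mk (pointSetoid hv) (p i) : CanonicalModel hv)) := by
  have H := fun x y e => ((tarskiClauses_hold_iff v x y r e).1 (hv x y r e)).2.2.2.2.2.2.2
  induction φ with
  | falsum =>
    simp only [formulaCode, LHom.onBoundedFormula, BoundedFormula.Realize, iff_false]
    exact (H 0 0 _).1
  | equal t u =>
    rw [formulaCode, (H _ _ _).2.1]
    simp only [LHom.onBoundedFormula, BoundedFormula.realize_bdEqual, ← mk_termPoint]
    exact (Quotient.eq (r := pointSetoid hv)).symm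
  | rel P ts =>
    rw [formulaCode, (H _ _ _).2.2.1, codedList_encode, List.map_ofFn]
    simp only [LHom.onBoundedFormula, BoundedFormula.realize_rel, Function.comp_apply,
      ← mk_termPoint]
    exact (relMap_mk hv _ _).symm
  | imp φ ψ ih₁ ih₂ =>
    rw [formulaCode, (H _ _ _).2.2.2.1]
    exact imp_congr (ih₁ p) (ih₂ p)
  | all φ ih =>
    have hsnoc : ∀ q : ℕ, (v (satAtom (formulaCode φ) r
        (Encodable.encode (codedList (Encodable.encode (List.ofFn p)) ++ [q]))) ↔
        ((renameHom (codedPerm r).toEmbedding).onBoundedFormula φ).Realize default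
          (Fin.snoc (fun i => (Quotient.mk (pointSetoid hv) (p i) : CanonicalModel hv))
            (Quotient.mk (pointSetoid hv) q))) := by
      intro q
      have h₁ : codedList (Encodable.encode (List.ofFn p)) ++ [q] =
          List.ofFn (Fin.snoc p q : Fin _ → ℕ) := by
        rw [Fin.snoc_eq_append, List.ofFn_fin_append]
        simp
      have h₂ : (Fin.snoc (fun i => (Quotient.mk (pointSetoid hv) (p i) : CanonicalModel hv))
            (Quotient.mk (pointSetoid hv) q) : Fin _ → CanonicalModel hv) =
          fun i => Quotient.mk (pointSetoid hv) ((Fin.snoc p q : Fin _ → ℕ) i) := by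
        funext i
        refine Fin.lastCases ?_ (fun i => ?_) i <;> simp
      rw [h₁, h₂]
      exact ih _
    rw [formulaCode]
    constructor
    · intro h
      refine fun x => Quotient.inductionOn x fun q => ?_
      exact (hsnoc q).1 ((H _ q _).2.2.2.2.1 h)
    · intro h
      exact (H _ 0 _).2.2.2.2.2 ((hsnoc _).2 (h _))

end CanonicalModel

/-! ### Recursive enumerability of logical consequence -/

open FirstOrder in
/-- `φ` holds in all (nonempty) structures in which all `ψ ∈ H` hold. -/
def EntailsFrom (H : Set Sentence) (φ : Sentence) : Prop :=
  ∀ (M : Type) [vocab.Structure M] [Nonempty M], (∀ ψ ∈ H, M ⊨ ψ) → M ⊨ φ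

theorem modelsBoundedFormula_iff (T : vocab.Theory) (φ : Sentence) :
    T ⊨ᵇ φ ↔ EntailsFrom T φ := by
  rw [FirstOrder.Language.Theory.models_sentence_iff]
  constructor
  · intro h M _ _ hM
    have : M ⊨ T := ⟨fun ψ hψ => hM ψ hψ⟩
    exact h (FirstOrder.Language.Theory.ModelType.of T M)
  · exact fun h M => h M fun ψ hψ => FirstOrder.Language.Theory.realize_sentence_of_mem T hψ

theorem renameSentence_codedPerm_zero (φ : Sentence) :
    renameSentence (codedPerm 0).toEmbedding φ = φ := by
  have : renameHom (codedPerm 0).toEmbedding = FirstOrder.Language.LHom.id vocab := by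
    rw [codedPerm_zero]
    refine FirstOrder.Language.LHom.funext ?_ rfl
    funext n f
    cases n <;> rfl
  rw [renameSentence, this]
  exact congrFun (FirstOrder.Language.LHom.id_onBoundedFormula (L := vocab)) φ

/-- The literals saying that the sentences `τ(ψ)` with `(ψ, τ)` in a list are true, and that `φ` is
false; sentences and permutations are given by codes. -/
def entailmentLits (l : List (ℕ × ℕ)) (m : ℕ) : List Lit :=
  (satAtom m 0 0, false) :: l.map fun x => (satAtom x.1 x.2 0, true)

/-- Completeness: logical consequence amounts to the propositional refutability of the clauses. -/
theorem refuted_entailmentLits_iff (l : List (Sentence × ℕ)) (φ : Sentence) :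
    Refuted tarskiFamily
        (entailmentLits (l.map fun x => (sentenceCode x.1, x.2)) (sentenceCode φ)) ↔
      EntailsFrom {ψ | ∃ x ∈ l, renameSentence (codedPerm x.2).toEmbedding x.1 = ψ} φ := by
  rw [refuted_iff, not_iff_comm]
  simp only [forall_tarskiFamily]
  have nilCode : ∀ (X : Type) (xs : Fin 0 → X), List.ofFn xs = [] := fun _ _ => List.ofFn_zero
  constructor
  · intro h
    simp only [EntailsFrom, not_forall] at h
    obtain ⟨M, _, ⟨d⟩, hM, hφ⟩ := h
    refine ⟨atomTruth (rawFun d) (rawRel d) d, ?_, atomTruth_tarskiClauses _ _ _⟩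
    have key : ∀ (ψ : Sentence) (r : ℕ),
        atomTruth (rawFun d) (rawRel d) d (satAtom (sentenceCode ψ) r 0) ↔
          M ⊨ renameSentence (codedPerm r).toEmbedding ψ := by
      intro ψ r
      rw [atomTruth_satAtom, codedList_zero, sentenceCode, List.map_nil,
        ← nilCode M default, rawSat_formulaCode]
      rfl
    intro x hx
    simp only [entailmentLits, List.map_map, List.mem_cons, List.mem_map] at hx
    rcases hx with rfl | ⟨y, hy, rfl⟩
    · simpa [Lit.Holds, key, renameSentence_codedPerm_zero] using hφ
    · simpa [Lit.Holds, key] using hM _ ⟨y, hy, rfl⟩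
  · rintro ⟨v, hs, hv⟩ h
    have key : ∀ (ψ : Sentence) (r : ℕ), v (satAtom (sentenceCode ψ) r 0) ↔
        CanonicalModel hv ⊨ renameSentence (codedPerm r).toEmbedding ψ := by
      intro ψ r
      have := satAtom_iff hv r ψ (default : Fin 0 → ℕ)
      rw [nilCode, Encodable.encode_list_nil] at this
      rw [sentenceCode, this]
      refine iff_of_eq (congrArg₂
        (FirstOrder.Language.BoundedFormula.Realize (L := vocab) (M := CanonicalModel hv) (l := 0)
          ((renameHom (codedPerm r).toEmbedding).onBoundedFormula ψ))
        (Subsingleton.elim _ _) (Subsingleton.elim _ _))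
    have : Nonempty (CanonicalModel hv) := ⟨Quotient.mk (pointSetoid hv) 0⟩
    have h₁ := h (CanonicalModel hv) (by
      rintro _ ⟨x, hx, rfl⟩
      rw [← key]
      have := hs (satAtom (sentenceCode x.1) x.2 0, true)
        (List.mem_cons_of_mem _ (List.mem_map.2 ⟨_, List.mem_map.2 ⟨x, hx, rfl⟩, rfl⟩))
      simpa [Lit.Holds] using this)
    have h₂ := hs _ (List.mem_cons_self ..)
    rw [← renameSentence_codedPerm_zero φ, ← key] at h₁
    simp [Lit.Holds, h₁] at h₂

/-! ### Primitive recursive predicates and their projections -/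

section Primrec

variable {α β : Type} [Primcodable α] [Primcodable β]

theorem _root_.PrimrecRel.forall_mem {f : α → List β} {p : α → β → Prop} (hf : Primrec f)
    (hp : PrimrecRel p) : PrimrecPred fun a => ∀ b ∈ f a, p a b :=
  hp.swap.forall_mem_list.comp hf Primrec.id

theorem _root_.PrimrecRel.exists_mem {f : α → List β} {p : α → β → Prop} (hf : Primrec f)
    (hp : PrimrecRel p) : PrimrecPred fun a => ∃ b ∈ f a, p a b :=
  hp.swap.exists_mem_list.comp hf Primrec.id

theorem _root_.PrimrecRel.forall_lt' {f : α → ℕ} {p : α → ℕ → Prop} (hf : Primrec f)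
    (hp : PrimrecRel p) : PrimrecPred fun a => ∀ b < f a, p a b :=
  (PrimrecRel.forall_mem (Primrec.list_range.comp hf) hp).of_eq (by simp)

theorem _root_.PrimrecRel.exists_lt' {f : α → ℕ} {p : α → ℕ → Prop} (hf : Primrec f)
    (hp : PrimrecRel p) : PrimrecPred fun a => ∃ b < f a, p a b :=
  (PrimrecRel.exists_mem (Primrec.list_range.comp hf) hp).of_eq (by simp)

/-- The projection of a primitive recursive relation is recursively enumerable. -/
theorem _root_.PrimrecRel.rePred_exists {p : α → β → Prop} (hp : PrimrecRel p) :
    REPred fun a => ∃ b, p a b := by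
  classical
  have h : Primrec₂ fun (a : α) (n : ℕ) =>
      (Encodable.decode (α := β) n).bind fun b => if p a b then some () else none := by
    refine Primrec.option_bind (Primrec.decode.comp Primrec.snd) ?_
    exact Primrec.ite (hp.comp (Primrec.fst.comp Primrec.fst) Primrec.snd) (Primrec.const _)
      (Primrec.const _)
  refine (Partrec.rfindOpt h.to_comp).dom_re.of_eq fun a => ?_
  rw [Nat.rfindOpt_dom]
  constructor
  · rintro ⟨n, u, hu⟩
    cases hd : Encodable.decode (α := β) n with
    | none => simp [hd] at hu
    | some b =>
      simp only [hd, Option.bind_some, Option.mem_def] at hu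
      split_ifs at hu with hb
      exact ⟨b, hb⟩
  · rintro ⟨b, hb⟩
    exact ⟨Encodable.encode b, (), by simp [hb]⟩

/-- A recursively enumerable predicate is the halting predicate of a program. -/
theorem _root_.REPred.exists_code {p : α → Prop} (hp : REPred p) :
    ∃ c : Nat.Partrec.Code, ∀ a, (c.eval (Encodable.encode a)).Dom ↔ p a := by
  obtain ⟨c, hc⟩ := Nat.Partrec.Code.exists_code.1 hp
  refine ⟨c, fun a => ?_⟩
  rw [hc]
  simp [Part.assert]

end Primrec

/-- The program `c` halts on input `n` with a computation of size at most `k`. -/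
def HaltsWithin (k : ℕ) (c : Nat.Partrec.Code) (n : ℕ) : Prop := (c.evaln k n).isSome

theorem primrec_haltsWithin {α : Type} [Primcodable α] {f : α → ℕ} {g : α → Nat.Partrec.Code}
    {h : α → ℕ} (hf : Primrec f) (hg : Primrec g) (hh : Primrec h) :
    PrimrecPred fun a => HaltsWithin (f a) (g a) (h a) := by
  have := Primrec.option_isSome.comp
    (Nat.Partrec.Code.primrec_evaln.comp ((hf.pair hg).pair hh))
  exact (Primrec.eq.comp this (Primrec.const true))

theorem HaltsWithin.mono {k l : ℕ} (hkl : k ≤ l) {c : Nat.Partrec.Code} {n : ℕ}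
    (h : HaltsWithin k c n) : HaltsWithin l c n := by
  obtain ⟨x, hx⟩ := Option.isSome_iff_exists.1 h
  exact Option.isSome_iff_exists.2 ⟨x, Nat.Partrec.Code.evaln_mono hkl hx⟩

theorem eval_dom_iff (c : Nat.Partrec.Code) (n : ℕ) : (c.eval n).Dom ↔ ∃ k, HaltsWithin k c n := by
  simp only [Part.dom_iff_mem, HaltsWithin, Option.isSome_iff_exists,
    Nat.Partrec.Code.evaln_complete, Option.mem_def]
  exact exists_comm

/-! ### Primitive recursiveness of the refutation relation -/

section Coding

variable {α : Type} [Primcodable α] {f g h : α → ℕ} {l : α → List ℕ}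

theorem primrec_codedList : Primrec codedList :=
  Primrec.encode_iff.1 (Primrec.id.of_eq fun n => (encode_codedList n).symm)

theorem primrec_codedPairs : Primrec codedPairs :=
  Primrec.encode_iff.1 (Primrec.id.of_eq fun n => by rw [codedPairs, Denumerable.encode_ofNat]; rfl)

theorem primrec_eqAtom (hf : Primrec f) (hg : Primrec g) :
    Primrec fun a => eqAtom (f a) (g a) :=
  Primrec₂.natPair.comp (Primrec.const 0) (Primrec₂.natPair.comp hf hg)

theorem primrec_relAtom (hf : Primrec f) (hl : Primrec l) :
    Primrec fun a => relAtom (f a) (l a) :=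
  Primrec₂.natPair.comp (Primrec.const 1) (Primrec₂.natPair.comp hf (Primrec.encode.comp hl))

theorem primrec_satAtom (hf : Primrec f) (hg : Primrec g) (hh : Primrec h) :
    Primrec fun a => satAtom (f a) (g a) (h a) :=
  Primrec₂.natPair.comp (Primrec.const 2) (Primrec₂.natPair.comp hf (Primrec₂.natPair.comp hg hh))

theorem primrec_termPoint (hf : Primrec f) (hg : Primrec g) (hh : Primrec h) :
    Primrec fun a => termPoint (f a) (g a) (h a) :=
  Primrec₂.natPair.comp (Primrec.const 0) (Primrec₂.natPair.comp hh (Primrec₂.natPair.comp hf hg))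

theorem primrec_funPoint (hf : Primrec f) (hl : Primrec l) :
    Primrec fun a => funPoint (f a) (l a) :=
  Primrec₂.natPair.comp (Primrec.const 1) (Primrec₂.natPair.comp hf (Primrec.encode.comp hl))

theorem primrec_witPoint (hf : Primrec f) (hg : Primrec g) (hh : Primrec h) :
    Primrec fun a => witPoint (f a) (g a) (h a) :=
  Primrec₂.natPair.comp (Primrec.const 2) (Primrec₂.natPair.comp hf (Primrec₂.natPair.comp hg hh))

theorem primrec_codedPerm (hf : Primrec f) (hg : Primrec g) :
    Primrec fun a => codedPerm (f a) (g a) := by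
  have key : ∀ (s : List (ℕ × ℕ)) (c : ℕ), s.foldr (fun ab x =>
      if x = ab.1 then ab.2 else if x = ab.2 then ab.1 else x) c = swapsPerm s c := by
    intro s c
    induction s with
    | nil => rfl
    | cons ab s ih =>
      rw [List.foldr_cons, ih, swapsPerm, swapsPerm, List.map_cons, List.prod_cons,
        Equiv.Perm.mul_apply, Equiv.swap_apply_def]
  refine (Primrec.list_foldr (h := fun _ p => if p.2 = p.1.1 then p.1.2 else
    if p.2 = p.1.2 then p.1.1 else p.2) (primrec_codedPairs.comp hf) hg ?_).of_eq
      fun a => key (codedPairs (f a)) (g a)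
  have s : Primrec fun p : α × (ℕ × ℕ) × ℕ => p.2.2 := Primrec.snd.comp Primrec.snd
  have a : Primrec fun p : α × (ℕ × ℕ) × ℕ => p.2.1.1 :=
    Primrec.fst.comp (Primrec.fst.comp Primrec.snd)
  have b : Primrec fun p : α × (ℕ × ℕ) × ℕ => p.2.1.2 :=
    Primrec.snd.comp (Primrec.fst.comp Primrec.snd)
  exact Primrec.ite (Primrec.eq.comp s a) b (Primrec.ite (Primrec.eq.comp s b) a s)

theorem primrec_renameSymbol (hf : Primrec f) (hg : Primrec g) :
    Primrec fun a => renameSymbol (f a) (g a) := by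
  have hu := Primrec.unpair.comp hg
  exact Primrec.ite (Primrec.eq.comp (Primrec.fst.comp hu) (Primrec.const 0))
    (Primrec₂.natPair.comp (Primrec.const 0) (primrec_codedPerm hf (Primrec.snd.comp hu))) hg

theorem primrec_tarskiFamily : Primrec tarskiFamily := by
  suffices H : Primrec fun p : ℕ × ℕ × ℕ × ℕ => tarskiClauses p.1 p.2.1 p.2.2.1 p.2.2.2 from
    H.comp (Primrec.ofNat (ℕ × ℕ × ℕ × ℕ))
  have x : Primrec fun p : ℕ × ℕ × ℕ × ℕ => p.1 := Primrec.fst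
  have y : Primrec fun p : ℕ × ℕ × ℕ × ℕ => p.2.1 := Primrec.fst.comp Primrec.snd
  have r : Primrec fun p : ℕ × ℕ × ℕ × ℕ => p.2.2.1 :=
    Primrec.fst.comp (Primrec.snd.comp Primrec.snd)
  have e : Primrec fun p : ℕ × ℕ × ℕ × ℕ => p.2.2.2 :=
    Primrec.snd.comp (Primrec.snd.comp Primrec.snd)
  have T {f : ℕ × ℕ × ℕ × ℕ → ℕ} (hf : Primrec f) : Primrec fun p => ((f p, true) : Lit) :=
    hf.pair (Primrec.const true)
  have F {f : ℕ × ℕ × ℕ × ℕ → ℕ} (hf : Primrec f) : Primrec fun p => ((f p, false) : Lit) :=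
    hf.pair (Primrec.const false)
  have C {β : Type} [Primcodable β] {f : ℕ × ℕ × ℕ × ℕ → β} {g : ℕ × ℕ × ℕ × ℕ → List β}
      (hf : Primrec f) (hg : Primrec g) : Primrec fun p => f p :: g p :=
    Primrec.list_cons.comp hf hg
  have N : Primrec fun _ : ℕ × ℕ × ℕ × ℕ => ([] : List Lit) := Primrec.const []
  have NN : Primrec fun _ : ℕ × ℕ × ℕ × ℕ => ([] : List (List Lit)) := Primrec.const []
  have lin (a b : ℕ) {f : ℕ × ℕ × ℕ × ℕ → ℕ} (hf : Primrec f) :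
      Primrec fun p => a * f p + b :=
    Primrec.nat_add.comp (Primrec.nat_mul.comp (Primrec.const a) hf) (Primrec.const b)
  have xy : Primrec fun p : ℕ × ℕ × ℕ × ℕ => Nat.pair p.1 p.2.1 := Primrec₂.natPair.comp x y
  have zs : Primrec fun p : ℕ × ℕ × ℕ × ℕ => codedPairs p.2.1 := primrec_codedPairs.comp y
  have fsts : Primrec fun p : ℕ × ℕ × ℕ × ℕ => (codedPairs p.2.1).map Prod.fst :=
    Primrec.list_map zs (Primrec.fst.comp Primrec.snd).to₂
  have snds : Primrec fun p : ℕ × ℕ × ℕ × ℕ => (codedPairs p.2.1).map Prod.snd :=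
    Primrec.list_map zs (Primrec.snd.comp Primrec.snd).to₂
  have eqs : Primrec fun p : ℕ × ℕ × ℕ × ℕ =>
      (codedPairs p.2.1).map fun z => ((eqAtom z.1 z.2, false) : Lit) :=
    Primrec.list_map zs ((primrec_eqAtom (Primrec.fst.comp Primrec.snd)
      (Primrec.snd.comp Primrec.snd)).pair (Primrec.const false)).to₂
  have ps : Primrec fun p : ℕ × ℕ × ℕ × ℕ =>
      (codedList p.2.1).map (termPoint p.2.2.1 p.2.2.2) :=
    Primrec.list_map (primrec_codedList.comp y)
      (primrec_termPoint (r.comp Primrec.fst) (e.comp Primrec.fst) Primrec.snd).to₂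
  have env : Primrec fun p : ℕ × ℕ × ℕ × ℕ => codedList p.2.2.2 := primrec_codedList.comp e
  have snoc {f : ℕ × ℕ × ℕ × ℕ → ℕ} (hf : Primrec f) :
      Primrec fun p => Encodable.encode (codedList p.2.2.2 ++ [f p]) :=
    Primrec.encode.comp (Primrec.list_concat.comp env hf)
  have tx := primrec_termPoint r e x
  have ty := primrec_termPoint r e y
  have eqt := primrec_eqAtom tx ty
  have relt := primrec_relAtom x ps
  have sx := primrec_satAtom x r e
  have sy := primrec_satAtom y r e
  have s0 := primrec_satAtom (Primrec.const 0) r e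
  have s1 := primrec_satAtom (lin 4 1 xy) r e
  have s2 := primrec_satAtom (lin 4 2 xy) r e
  have s3 := primrec_satAtom (lin 4 3 xy) r e
  have s4 := primrec_satAtom (lin 4 4 x) r e
  refine C (C (T (primrec_eqAtom x x)) N) ?_
  refine C (C (F (primrec_eqAtom x y)) <| C (T (primrec_eqAtom y x)) N) ?_
  refine C (C (F (primrec_eqAtom x y)) <| C (F (primrec_eqAtom y r)) <|
    C (T (primrec_eqAtom x r)) N) ?_
  refine C (C (T (primrec_eqAtom (primrec_funPoint x fsts) (primrec_funPoint x snds))) eqs) ?_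
  refine C (C (F (primrec_relAtom x fsts)) <| C (T (primrec_relAtom x snds)) eqs) ?_
  refine C (C (T (primrec_eqAtom (primrec_termPoint r e (lin 2 0 x))
    ((Primrec.list_getD 0).comp env x))) N) ?_
  refine C (C (T (primrec_eqAtom (primrec_termPoint r e (lin 2 1 xy))
    (primrec_funPoint (primrec_renameSymbol r x) ps))) N) ?_
  refine C (C (F s0) N) ?_
  refine C (C (F s1) <| C (T eqt) N) <| C (C (T s1) <| C (F eqt) N) ?_
  refine C (C (F s2) <| C (T relt) N) <| C (C (T s2) <| C (F relt) N) ?_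
  refine C (C (F s3) <| C (F sx) <| C (T sy) N) ?_
  refine C (C (T s3) <| C (T sx) N) <| C (C (T s3) <| C (F sy) N) ?_
  refine C (C (F s4) <| C (T (primrec_satAtom x r (snoc y))) N) ?_
  exact C (C (T s4) <| C (F (primrec_satAtom x r (snoc (primrec_witPoint x r e)))) N) NN

theorem primrec_nat_pow : Primrec₂ fun a b : ℕ => a ^ b :=
  Primrec₂.unpaired'.1 Nat.Primrec.pow

theorem primrec_falseAt {f g : α → ℕ} {x : α → Lit} (hf : Primrec f) (hg : Primrec g)
    (hx : Primrec x) : PrimrecPred fun a => (x a).FalseAt (f a) (g a) := by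
  have h₁ := Primrec.fst.comp hx
  refine (Primrec.nat_lt.comp h₁ hf).and (PrimrecPred.not (Primrec.eq.comp ?_ ?_))
  · exact Primrec.nat_mod.comp (Primrec.nat_div.comp hg
      (primrec_nat_pow.comp (Primrec.const 2) h₁)) (Primrec.const 2)
  · exact (Primrec.dom_finite Bool.toNat).comp (Primrec.snd.comp hx)

theorem primrec_refutedAt {f : α → ℕ} {s : α → List Lit} {C : ℕ → List (List Lit)}
    (hf : Primrec f) (hC : Primrec C) (hs : Primrec s) :
    PrimrecPred fun a => RefutedAt (f a) C (s a) := by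
  refine PrimrecRel.forall_lt' (primrec_nat_pow.comp (Primrec.const 2) hf) ?_
  refine PrimrecPred.or ?_ ?_
  · refine PrimrecRel.exists_mem (p := fun (q : α × ℕ) (x : Lit) => x.FalseAt (f q.1) q.2)
      (hs.comp Primrec.fst) ?_
    exact primrec_falseAt (hf.comp (Primrec.fst.comp Primrec.fst)) (Primrec.snd.comp Primrec.fst)
      Primrec.snd
  · refine PrimrecRel.exists_lt' (p := fun (q : α × ℕ) k => ∃ c ∈ C k, ∀ x ∈ c,
      Lit.FalseAt (f q.1) q.2 x) (hf.comp Primrec.fst) ?_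
    refine PrimrecRel.exists_mem (p := fun (q : (α × ℕ) × ℕ) c => ∀ x ∈ c,
      Lit.FalseAt (f q.1.1) q.1.2 x) (hC.comp Primrec.snd) ?_
    refine PrimrecRel.forall_mem (p := fun (q : ((α × ℕ) × ℕ) × List Lit) x =>
      Lit.FalseAt (f q.1.1.1) q.1.1.2 x) Primrec.snd ?_
    exact primrec_falseAt
      (hf.comp (Primrec.fst.comp (Primrec.fst.comp (Primrec.fst.comp Primrec.fst))))
      (Primrec.snd.comp (Primrec.fst.comp (Primrec.fst.comp Primrec.fst))) Primrec.snd

theorem primrec_entailmentLits {l : α → List (ℕ × ℕ)} {f : α → ℕ} (hl : Primrec l)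
    (hf : Primrec f) : Primrec fun a => entailmentLits (l a) (f a) := by
  refine Primrec.list_cons.comp
    ((primrec_satAtom hf (Primrec.const 0) (Primrec.const 0)).pair (Primrec.const false))
    (Primrec.list_map hl ?_)
  exact ((primrec_satAtom (Primrec.fst.comp Primrec.snd) (Primrec.snd.comp Primrec.snd)
    (Primrec.const 0)).pair (Primrec.const true)).to₂

end Coding

/-! ### The knowledge base generated by a set of pairs -/

section Renaming

open FirstOrder FirstOrder.Language

theorem renameHom_trans (τ τ' : Const ↪ Const) :
    renameHom (τ.trans τ') = (renameHom τ').comp (renameHom τ) := by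
  refine LHom.funext ?_ rfl
  funext n f
  cases n <;> rfl

theorem renameSentence_trans (τ τ' : Const ↪ Const) (φ : Sentence) :
    renameSentence (τ.trans τ') φ = renameSentence τ' (renameSentence τ φ) := by
  rw [renameSentence, renameHom_trans]
  exact congrFun (LHom.comp_onBoundedFormula (renameHom τ') (renameHom τ)) φ

theorem renameSentence_refl (φ : Sentence) :
    renameSentence (Function.Embedding.refl _) φ = φ := by
  have : renameHom (Function.Embedding.refl _) = LHom.id vocab := by
    refine LHom.funext ?_ rfl
    funext n f
    cases n <;> rfl
  rw [renameSentence, this]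
  exact congrFun (LHom.id_onBoundedFormula (L := vocab)) φ

/-- Consequence is stable under renaming constants: a model of the renamed sentences becomes a model
of the original ones when each constant `c` is interpreted as `τ c`. -/
theorem EntailsFrom.rename {H : Set Sentence} {φ : Sentence} (h : EntailsFrom H φ)
    (τ : Const ↪ Const) : EntailsFrom (renameSentence τ '' H) (renameSentence τ φ) := by
  intro M S₀ _ hM
  have key : ∀ ψ : Sentence, @Sentence.Realize vocab M S₀ (renameSentence τ ψ) ↔
      @Sentence.Realize vocab M ((renameHom τ).reduct M) ψ := fun ψ =>
    @LHom.realize_onSentence vocab vocab M ((renameHom τ).reduct M) S₀ (renameHom τ)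
      (LHom.isExpansionOn_reduct _ M) ψ
  rw [key]
  exact @h M ((renameHom τ).reduct M) _ fun ψ hψ => (key ψ).1 (hM _ ⟨ψ, hψ, rfl⟩)

theorem onTerm_congr {α : Type} (t : vocab.Term α) :
    ∃ N, ∀ τ τ' : Const ↪ Const, (∀ c < N, τ c = τ' c) →
      (renameHom τ).onTerm t = (renameHom τ').onTerm t := by
  induction t with
  | var => exact ⟨0, fun _ _ _ => rfl⟩
  | @func l f ts ih =>
    choose N hN using ih
    obtain ⟨B, hB⟩ := (Set.finite_range N).bddAbove
    refine ⟨max B (f + 1), fun τ τ' h => ?_⟩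
    simp only [LHom.onTerm]
    congr 1
    · cases l with
      | zero => exact h f (lt_of_lt_of_le (Nat.lt_succ_self f) (le_max_right _ _))
      | succ => rfl
    · funext i
      exact hN i τ τ' fun c hc =>
        h c (hc.trans_le ((hB ⟨i, rfl⟩).trans (le_max_left _ _)))

theorem onBoundedFormula_congr {n : ℕ} (φ : vocab.BoundedFormula Empty n) :
    ∃ N, ∀ τ τ' : Const ↪ Const, (∀ c < N, τ c = τ' c) →
      (renameHom τ).onBoundedFormula φ = (renameHom τ').onBoundedFormula φ := by
  induction φ with
  | falsum => exact ⟨0, fun _ _ _ => rfl⟩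
  | equal t u =>
    obtain ⟨N₁, h₁⟩ := onTerm_congr t
    obtain ⟨N₂, h₂⟩ := onTerm_congr u
    refine ⟨max N₁ N₂, fun τ τ' h => ?_⟩
    simp only [LHom.onBoundedFormula]
    rw [h₁ τ τ' fun c hc => h c (hc.trans_le (le_max_left _ _)),
      h₂ τ τ' fun c hc => h c (hc.trans_le (le_max_right _ _))]
  | rel P ts =>
    choose N hN using fun i => onTerm_congr (ts i)
    obtain ⟨B, hB⟩ := (Set.finite_range N).bddAbove
    refine ⟨B, fun τ τ' h => ?_⟩
    have : (renameHom τ).onTerm ∘ ts = (renameHom τ').onTerm ∘ ts :=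
      funext fun i => hN i τ τ' fun c hc => h c (hc.trans_le (hB ⟨i, rfl⟩))
    simp only [LHom.onBoundedFormula]
    rw [this]
    rfl
  | imp φ ψ ih₁ ih₂ =>
    obtain ⟨N₁, h₁⟩ := ih₁
    obtain ⟨N₂, h₂⟩ := ih₂
    refine ⟨max N₁ N₂, fun τ τ' h => ?_⟩
    simp only [LHom.onBoundedFormula]
    rw [h₁ τ τ' fun c hc => h c (hc.trans_le (le_max_left _ _)),
      h₂ τ τ' fun c hc => h c (hc.trans_le (le_max_right _ _))]
  | all φ ih =>
    obtain ⟨N, hN⟩ := ih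
    refine ⟨N, fun τ τ' h => ?_⟩
    simp only [LHom.onBoundedFormula]
    rw [hN τ τ' h]

/-- Only finitely many constants occur in a sentence. -/
theorem exists_renameSentence_congr (φ : Sentence) :
    ∃ N, ∀ τ τ' : Const ↪ Const, (∀ c < N, τ c = τ' c) →
      renameSentence τ φ = renameSentence τ' φ :=
  onBoundedFormula_congr φ

end Renaming

theorem EntailsFrom.mono {H H' : Set Sentence} {φ : Sentence} (h : EntailsFrom H φ)
    (hH : H ⊆ H') : EntailsFrom H' φ :=
  fun M _ _ hM => h M fun ψ hψ => hM ψ (hH hψ)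

theorem isTautology_iff (φ : Sentence) : IsTautology φ ↔ EntailsFrom ∅ φ :=
  modelsBoundedFormula_iff _ _

theorem entails_iff (φ ψ : Sentence) : Entails φ ψ ↔ EntailsFrom {φ} ψ :=
  modelsBoundedFormula_iff _ _

namespace Database

variable {σ : Signature}

theorem rename_val_rename (τ : Const ↪ Const) (D : Database σ) (α : Fact) :
    (D.rename τ).val (α.rename τ) = D.val α := by
  simp only [Database.rename]
  exact (Fact.rename_injective τ).extend_apply D.val _ α

open Classical in
theorem rename_val_of_not_exists (τ : Const ↪ Const) (D : Database σ) {β : Fact}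
    (h : ¬ ∃ α, Fact.rename τ α = β) :
    (D.rename τ).val β = if β.pred ∈ σ.preds β.arity ∧ IsCWA β.pred then some (-1) else none := by
  simp only [Database.rename]
  exact Function.extend_apply' D.val _ β h

theorem Extends.trans {D₁ D₂ D₃ : Database σ} (h : D₁.Extends D₂) (h' : D₂.Extends D₃) :
    D₁.Extends D₃ := fun α v hv => h α v (h' α v hv)

theorem Extends.rename {D₀ D : Database σ} (h : D₀.Extends D) (τ : Const ↪ Const) :
    (D₀.rename τ).Extends (D.rename τ) := by
  intro β v hv
  by_cases hβ : ∃ α, Fact.rename τ α = β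
  · obtain ⟨α, rfl⟩ := hβ
    rw [rename_val_rename] at hv ⊢
    exact h α v hv
  · rw [rename_val_of_not_exists _ _ hβ] at hv ⊢
    exact hv

theorem extends_rename_refl (D : Database σ) :
    D.Extends (D.rename (Function.Embedding.refl _)) := by
  intro β v hv
  have : Fact.rename (Function.Embedding.refl _) β = β := rfl
  rwa [← this, rename_val_rename] at hv

theorem rename_extends_rename_trans (D : Database σ) (τ τ' : Const ↪ Const) :
    ((D.rename τ).rename τ').Extends (D.rename (τ.trans τ')) := by
  intro β v hv
  by_cases hβ : ∃ α, Fact.rename τ' α = β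
  · obtain ⟨α, rfl⟩ := hβ
    rw [rename_val_rename]
    by_cases hα : ∃ γ, Fact.rename τ γ = α
    · obtain ⟨γ, rfl⟩ := hα
      rw [rename_val_rename]
      have : (γ.rename τ).rename τ' = γ.rename (τ.trans τ') := rfl
      rwa [this, rename_val_rename] at hv
    · rw [rename_val_of_not_exists _ _ hα]
      rw [rename_val_of_not_exists] at hv
      · exact hv
      · rintro ⟨γ, hγ⟩
        exact hα ⟨γ, Fact.rename_injective τ' hγ⟩
  · rw [rename_val_of_not_exists _ _ hβ]
    rw [rename_val_of_not_exists] at hv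
    · exact hv
    · rintro ⟨γ, hγ⟩
      exact hβ ⟨γ.rename τ, hγ⟩

theorem IsPositive.rename {D : Database σ} (h : D.IsPositive) (τ : Const ↪ Const) :
    (D.rename τ).IsPositive := by
  intro β hβ
  by_cases hβ' : ∃ α, Fact.rename τ α = β
  · obtain ⟨α, rfl⟩ := hβ'
    rw [rename_val_rename] at hβ
    exact h α hβ
  · rw [rename_val_of_not_exists _ _ hβ'] at hβ
    split_ifs at hβ
    simp at hβ

end Database

section Closure

variable {σ : Signature} {𝒟 : Set (Database σ)} {𝒬 : Set Sentence}

/-- `(D, φ)` follows from `K`: for finitely many `(Dᵢ, φᵢ) ∈ K` and injections `τᵢ` such that `D`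
extends `τᵢ(Dᵢ)`, the sentences `τᵢ(φᵢ)` entail `φ`. -/
def FollowsFrom (K : Set (Database σ × Sentence)) (D : Database σ) (φ : Sentence) : Prop :=
  ∃ l : List (Database σ × Sentence × (Const ↪ Const)),
    (∀ x ∈ l, (x.1, x.2.1) ∈ K ∧ D.Extends (x.1.rename x.2.2)) ∧
      EntailsFrom {ψ | ∃ x ∈ l, renameSentence x.2.2 x.2.1 = ψ} φ

theorem isKB_followsFrom {σQ : Signature} (h𝒬 : IsQueryLanguage σQ 𝒬)
    (h𝒟 : ∀ D ∈ 𝒟, ∀ τ, D.rename τ ∈ 𝒟) (K : Set (Database σ × Sentence)) :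
    IsKB 𝒟 𝒬 {x | x ∈ 𝒟 ×ˢ 𝒬 ∧ FollowsFrom K x.1 x.2} where
  subset _ hx := hx.1
  tautology D hD φ hφ h :=
    ⟨⟨hD, hφ⟩, [], by simp, ((isTautology_iff φ).1 h).mono (Set.empty_subset _)⟩
  implication := by
    rintro D φ ⟨⟨hD, -⟩, l, hl, h⟩ ψ hψ hφψ
    refine ⟨⟨hD, hψ⟩, l, hl, fun M _ _ hM => (entails_iff φ ψ).1 hφψ M ?_⟩
    rintro _ rfl
    exact h M hM
  conj := by
    rintro D φ ψ ⟨⟨hD, hφ⟩, l, hl, h⟩ ⟨⟨-, hψ⟩, l', hl', h'⟩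
    refine ⟨⟨hD, h𝒬.conj φ hφ ψ hψ⟩, l ++ l', ?_, ?_⟩
    · intro x hx
      rcases List.mem_append.1 hx with hx | hx
      exacts [hl x hx, hl' x hx]
    · intro M _ _ hM
      have h₁ := h M fun χ ⟨x, hx, hχ⟩ => hM χ ⟨x, List.mem_append_left _ hx, hχ⟩
      have h₂ := h' M fun χ ⟨x, hx, hχ⟩ => hM χ ⟨x, List.mem_append_right _ hx, hχ⟩
      exact FirstOrder.Language.BoundedFormula.realize_inf.2 ⟨h₁, h₂⟩
  extension := by
    rintro D φ ⟨⟨-, hφ⟩, l, hl, h⟩ D₀ hD₀ hext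
    exact ⟨⟨hD₀, hφ⟩, l, fun x hx => ⟨(hl x hx).1, hext.trans (hl x hx).2⟩, h⟩
  rename := by
    rintro D φ ⟨⟨hD, hφ⟩, l, hl, h⟩ τ
    refine ⟨⟨h𝒟 D hD τ, h𝒬.rename τ φ hφ⟩, l.map fun x => (x.1, x.2.1, x.2.2.trans τ), ?_, ?_⟩
    · intro y hy
      obtain ⟨x, hx, rfl⟩ := List.mem_map.1 hy
      exact ⟨(hl x hx).1, ((hl x hx).2.rename τ).trans (x.1.rename_extends_rename_trans x.2.2 τ)⟩
    · refine (h.rename τ).mono ?_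
      rintro _ ⟨_, ⟨x, hx, rfl⟩, rfl⟩
      exact ⟨_, List.mem_map.2 ⟨x, hx, rfl⟩, renameSentence_trans _ _ _⟩

theorem IsKB.mem_of_followsFrom {K : Set (Database σ × Sentence)} (hK : IsKB 𝒟 𝒬 K)
    {D : Database σ} {φ : Sentence} (hD : D ∈ 𝒟) (hφ : φ ∈ 𝒬) (h : FollowsFrom K D φ) :
    (D, φ) ∈ K := by
  obtain ⟨l, hl, h⟩ := h
  -- The finitely many premises are combined into a single one, their conjunction `χ`; the empty
  -- list is exceptional, as there need not be a tautology in `𝒬`.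
  have key : ∀ l : List (Database σ × Sentence × (Const ↪ Const)), l ≠ [] →
      (∀ x ∈ l, (x.1, x.2.1) ∈ K ∧ D.Extends (x.1.rename x.2.2)) →
      ∃ χ, (D, χ) ∈ K ∧ ∀ (M : Type) [vocab.Structure M] [Nonempty M], M ⊨ χ →
        ∀ x ∈ l, M ⊨ renameSentence x.2.2 x.2.1 := by
    intro l
    induction l with
    | nil => exact fun h => absurd rfl h
    | cons x l ih =>
      intro _ hl
      have hx := hl x (by simp)
      have hx' : (D, renameSentence x.2.2 x.2.1) ∈ K :=
        hK.extension _ _ (hK.rename _ _ hx.1 _) D hD hx.2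
      by_cases hnil : l = []
      · subst hnil
        exact ⟨_, hx', fun M _ _ hM y hy => by rw [List.mem_singleton.1 hy]; exact hM⟩
      · obtain ⟨χ, hχ, hχ'⟩ := ih hnil fun y hy => hl y (List.mem_cons_of_mem _ hy)
        refine ⟨_, hK.conj _ _ _ hx' hχ, fun M _ _ hM y hy => ?_⟩
        have hM := FirstOrder.Language.BoundedFormula.realize_inf.1 hM
        rcases List.mem_cons.1 hy with rfl | hy
        exacts [hM.1, hχ' M hM.2 y hy]
  by_cases hnil : l = []
  · subst hnil
    refine hK.tautology D hD φ hφ ((isTautology_iff φ).2 (h.mono ?_))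
    rintro _ ⟨x, hx, -⟩
    simp at hx
  · obtain ⟨χ, hχ, hχ'⟩ := key l hnil hl
    refine hK.implication D χ hχ φ hφ ((entails_iff χ φ).2 fun M _ _ hM => h M ?_)
    rintro _ ⟨x, hx, rfl⟩
    exact hχ' M (hM χ rfl) x hx

theorem subset_closure (K : Set (Database σ × Sentence)) : K ⊆ closure 𝒟 𝒬 K :=
  fun _ hx _ hK' => hK'.2 hx

theorem IsKB.closure_eq {K : Set (Database σ × Sentence)} (hK : IsKB 𝒟 𝒬 K) :
    closure 𝒟 𝒬 K = K :=
  Set.Subset.antisymm (fun _ hx => hx K ⟨hK, subset_rfl⟩) (subset_closure K)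

/-- The closure is reached in one step: rename finitely many members, extend the databases to `D`,
and draw a logical consequence. -/
theorem closure_eq_followsFrom {σQ : Signature} (h𝒬 : IsQueryLanguage σQ 𝒬)
    (h𝒟 : ∀ D ∈ 𝒟, ∀ τ, D.rename τ ∈ 𝒟) {K : Set (Database σ × Sentence)} (hK : K ⊆ 𝒟 ×ˢ 𝒬) :
    closure 𝒟 𝒬 K = {x | x ∈ 𝒟 ×ˢ 𝒬 ∧ FollowsFrom K x.1 x.2} := by
  refine Set.Subset.antisymm (Set.sInter_subset_of_mem ⟨isKB_followsFrom h𝒬 h𝒟 K, ?_⟩) ?_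
  · rintro ⟨D, φ⟩ hx
    refine ⟨hK hx, [(D, φ, Function.Embedding.refl _)], ?_, fun M _ _ hM => hM φ ?_⟩
    · intro y hy
      rw [List.mem_singleton.1 hy]
      exact ⟨hx, D.extends_rename_refl⟩
    · exact ⟨_, List.mem_singleton_self _, renameSentence_refl φ⟩
  · rintro ⟨D, φ⟩ ⟨⟨hD, hφ⟩, l, hl, h⟩ K' ⟨hK', hKK'⟩
    exact hK'.mem_of_followsFrom hD hφ ⟨l, fun x hx => ⟨hKK' (hl x hx).1, (hl x hx).2⟩, h⟩

theorem isKB_closure {σQ : Signature} (h𝒬 : IsQueryLanguage σQ 𝒬)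
    (h𝒟 : ∀ D ∈ 𝒟, ∀ τ, D.rename τ ∈ 𝒟) {K : Set (Database σ × Sentence)} (hK : K ⊆ 𝒟 ×ˢ 𝒬) :
    IsKB 𝒟 𝒬 (closure 𝒟 𝒬 K) := by
  rw [closure_eq_followsFrom h𝒬 h𝒟 hK]
  exact isKB_followsFrom h𝒬 h𝒟 K

end Closure

/-! ### Extension of databases in terms of codes -/

section FactCodes

/-- The action of a renaming of constants on the codes `Nat.pair α.code b` of observations. -/
def renameCode (τ : ℕ → ℕ) (x : ℕ) : ℕ :=
  Nat.pair (Nat.pair x.unpair.1.unpair.1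
    (Encodable.encode ((codedList x.unpair.1.unpair.2).map τ))) x.unpair.2

theorem renameCode_pair (τ : Const ↪ Const) (α : Fact) (b : ℕ) :
    renameCode τ (Nat.pair α.code b) = Nat.pair (α.rename τ).code b := by
  simp [renameCode, Fact.code, Fact.rename, Function.comp_def]

theorem renameCode_renameCode (τ τ' : ℕ → ℕ) (x : ℕ) :
    renameCode τ' (renameCode τ x) = renameCode (τ' ∘ τ) x := by
  simp [renameCode]

theorem renameCode_id (x : ℕ) : renameCode id x = x := by
  simp [renameCode]

theorem Fact.code_injective : Function.Injective Fact.code := by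
  rintro ⟨n, P, a⟩ ⟨m, R, b⟩ h
  simp only [Fact.code, Nat.pair_eq_pair, Encodable.encode_inj] at h
  obtain ⟨⟨rfl, hP⟩, hab⟩ := h
  subst hP
  rw [List.ofFn_injective hab]

/-- The observation with code `x` has a CWA-predicate symbol. -/
def IsCWACode (x : ℕ) : Prop := x.unpair.1.unpair.1.unpair.2 % 2 = 1

theorem isCWACode_pair (α : Fact) (b : ℕ) : IsCWACode (Nat.pair α.code b) ↔ IsCWA α.pred := by
  obtain ⟨n, P, a⟩ := α
  simp only [IsCWACode, Fact.code, Nat.unpair_pair, IsCWA]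
  rcases P with i | i
  · have : Encodable.encode (Sum.inl i : vocab.Relations n) = 2 * i := Encodable.encode_inl i
    rw [this]
    simp
  · have : Encodable.encode (Sum.inr i : vocab.Relations n) = 2 * i + 1 := Encodable.encode_inr i
    rw [this]
    simp

end FactCodes

namespace Database

variable {σ : Signature}

theorem mem_codedList_code (D : Database σ) (x : ℕ) : x ∈ codedList D.code ↔
    ∃ α, (D.val α = some 1 ∧ x = Nat.pair α.code 1) ∨
      (D.val α = some 0 ∧ x = Nat.pair α.code 0) := by
  rw [code, codedList_encode, Finset.mem_sort, Finset.mem_image]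
  refine exists_congr fun α => ?_
  rw [Set.Finite.mem_toFinset]
  constructor
  · rintro ⟨h | h, rfl⟩
    · simp [h]
    · simp [h]
  · rintro (⟨h, rfl⟩ | ⟨h, rfl⟩)
    · simp [h]
    · simp [h]

theorem pair_one_mem_iff (D : Database σ) (α : Fact) :
    Nat.pair α.code 1 ∈ codedList D.code ↔ D.val α = some 1 := by
  rw [mem_codedList_code]
  constructor
  · rintro ⟨β, ⟨h, h'⟩ | ⟨h, h'⟩⟩
    · rwa [Fact.code_injective (Nat.pair_eq_pair.1 h').1]
    · exact absurd (Nat.pair_eq_pair.1 h').2 (by simp)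
  · exact fun h => ⟨α, Or.inl ⟨h, rfl⟩⟩

theorem pair_zero_mem_iff (D : Database σ) (α : Fact) :
    Nat.pair α.code 0 ∈ codedList D.code ↔ D.val α = some 0 := by
  rw [mem_codedList_code]
  constructor
  · rintro ⟨β, ⟨h, h'⟩ | ⟨h, h'⟩⟩
    · exact absurd (Nat.pair_eq_pair.1 h').2 (by simp)
    · rwa [Fact.code_injective (Nat.pair_eq_pair.1 h').1]
  · exact fun h => ⟨α, Or.inr ⟨h, rfl⟩⟩

/-- Every value of a database other than `-1` is observed, hence recorded in its code. -/
theorem exists_pair_mem_of_val (D : Database σ) {α : Fact} {v : SignType} (h : D.val α = some v)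
    (hv : v ≠ -1) : ∃ b, Nat.pair α.code b ∈ codedList D.code := by
  rcases v with _ | _ | _
  · exact ⟨0, (D.pair_zero_mem_iff α).2 h⟩
  · exact absurd rfl hv
  · exact ⟨1, (D.pair_one_mem_iff α).2 h⟩

end Database

/-- The number `δ` codes a strictly increasing list of observations whose renaming by the finite
permutation `r` is a subset of the observations coded by `d` and contains all observations coded by
`d` that have a CWA-predicate symbol. For codes of databases this says that the second database
extends the renaming of the first, see `Database.exists_of_extendsCode`. -/
def ExtendsCode (d δ r : ℕ) : Prop :=
  (∀ i < (codedList δ).length, ∀ j < i, (codedList δ).getD j 0 < (codedList δ).getD i 0) ∧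
  (∀ x ∈ codedList δ, ∃ y ∈ codedList d, renameCode (codedPerm r) x = y) ∧
  ∀ y ∈ codedList d, IsCWACode y → ∃ x ∈ codedList δ, renameCode (codedPerm r) x = y

theorem sorted_iff_getD (l : List ℕ) :
    (∀ i < l.length, ∀ j < i, l.getD j 0 < l.getD i 0) ↔ l.Pairwise (· < ·) := by
  rw [List.pairwise_iff_getElem]
  constructor
  · intro h i j hi hj hij
    have := h j hj i hij
    simpa [List.getD, hi, hj] using this
  · intro h i hi j hj
    simpa [List.getD, hi, hj.trans hi] using h j i (hj.trans hi) hi hj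

namespace Database

variable {σ : Signature}

/-- If `D` extends `τ(D')` then the codes witness this for some finite permutation that agrees with
`τ` on a given initial segment. -/
theorem exists_extendsCode_of_extends {D D' : Database σ} {τ : Const ↪ Const}
    (h : D.Extends (D'.rename τ)) :
    ∃ N, ∀ r, (∀ c < N, codedPerm r c = τ c) → ExtendsCode D.code D'.code r := by
  obtain ⟨N, hN⟩ : ∃ N, ∀ α, (D'.val α = some 1 ∨ D'.val α = some 0) → ∀ i, α.args i < N := by
    obtain ⟨B, hB⟩ := (D'.finite_observed.biUnion fun α _ => Set.finite_range α.args).bddAbove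
    exact ⟨B + 1, fun α hα i => Nat.lt_succ_of_le (hB (Set.mem_biUnion hα ⟨i, rfl⟩))⟩
  refine ⟨N, fun r hr => ?_⟩
  have hren : ∀ α, (D'.val α = some 1 ∨ D'.val α = some 0) →
      α.rename (codedPerm r).toEmbedding = α.rename τ := by
    intro α hα
    simp only [Fact.rename, Fact.mk.injEq, heq_eq_eq, true_and]
    exact funext fun i => hr _ (hN α hα i)
  refine ⟨?_, ?_, ?_⟩
  · rw [sorted_iff_getD, code, codedList_encode]
    exact (Finset.sortedLT_sort _).pairwise
  · intro x hx
    refine ⟨_, ?_, rfl⟩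
    obtain ⟨α, ⟨hα, rfl⟩ | ⟨hα, rfl⟩⟩ := (D'.mem_codedList_code x).1 hx
    · have h' := renameCode_pair (codedPerm r).toEmbedding α 1
      rw [hren α (Or.inl hα)] at h'
      exact h' ▸ (D.pair_one_mem_iff _).2 (h _ _ (by rwa [rename_val_rename]))
    · have h' := renameCode_pair (codedPerm r).toEmbedding α 0
      rw [hren α (Or.inr hα)] at h'
      exact h' ▸ (D.pair_zero_mem_iff _).2 (h _ _ (by rwa [rename_val_rename]))
  · intro y hy hcwa
    -- As the renamed database decides all CWA-facts, what `D` observes about them comes from `D'`.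
    have key : ∀ β v, D.val β = some v → v ≠ -1 → IsCWA β.pred →
        ∃ α, (D'.val α = some v) ∧ α.rename τ = β := by
      intro β v hβ hv hc
      have hov := D.isOver β (by simp [hβ])
      obtain ⟨w, hw⟩ := Option.ne_none_iff_exists'.1 ((D'.rename τ).cwa_complete β hov hc)
      have hwv : w = v := by
        have := h β w hw
        rw [hβ] at this
        exact (Option.some_injective _ this).symm
      subst hwv
      by_cases hβ' : ∃ α, Fact.rename τ α = β
      · obtain ⟨α, rfl⟩ := hβ'
        exact ⟨α, by rwa [rename_val_rename] at hw, rfl⟩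
      · rw [rename_val_of_not_exists _ _ hβ', if_pos ⟨hov, hc⟩] at hw
        exact absurd (Option.some_injective _ hw).symm hv
    obtain ⟨β, ⟨hβ, rfl⟩ | ⟨hβ, rfl⟩⟩ := (D.mem_codedList_code y).1 hy
    · obtain ⟨α, hα, rfl⟩ := key β 1 hβ (by decide) ((isCWACode_pair β 1).1 hcwa)
      refine ⟨_, (D'.pair_one_mem_iff α).2 hα, ?_⟩
      rw [← hren α (Or.inl hα)]
      exact renameCode_pair (codedPerm r).toEmbedding α 1
    · obtain ⟨α, hα, rfl⟩ := key β 0 hβ (by decide) ((isCWACode_pair β 0).1 hcwa)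
      refine ⟨_, (D'.pair_zero_mem_iff α).2 hα, ?_⟩
      rw [← hren α (Or.inr hα)]
      exact renameCode_pair (codedPerm r).toEmbedding α 0

open Classical in
/-- The database whose observations are listed in `l`. -/
noncomputable def ofObservations (σ : Signature) (l : List ℕ)
    (hpred : ∀ (α : Fact) (b : ℕ), Nat.pair α.code b ∈ l → α.pred ∈ σ.preds α.arity) :
    Database σ where
  val α := if Nat.pair α.code 1 ∈ l then some 1
    else if Nat.pair α.code 0 ∈ l then some 0
    else if α.pred ∈ σ.preds α.arity ∧ IsCWA α.pred then some (-1) else none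
  isOver α hα := by
    by_cases h₁ : Nat.pair α.code 1 ∈ l
    · exact hpred α 1 h₁
    by_cases h₀ : Nat.pair α.code 0 ∈ l
    · exact hpred α 0 h₀
    by_contra hc
    rw [if_neg h₁, if_neg h₀, if_neg fun h => hc h.1] at hα
    exact hα rfl
  finite_observed := by
    have hfin : Set.Finite {x | x ∈ l} := l.finite_toSet
    refine ((hfin.preimage (f := fun α : Fact => Nat.pair α.code 1) ?_).union
      (hfin.preimage (f := fun α : Fact => Nat.pair α.code 0) ?_)).subset ?_
    · exact fun α _ β _ hαβ => Fact.code_injective (Nat.pair_eq_pair.1 hαβ).1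
    · exact fun α _ β _ hαβ => Fact.code_injective (Nat.pair_eq_pair.1 hαβ).1
    · intro α hα
      by_cases h₁ : Nat.pair α.code 1 ∈ l
      · exact Or.inl h₁
      by_cases h₀ : Nat.pair α.code 0 ∈ l
      · exact Or.inr h₀
      rw [Set.mem_ofPred_eq, if_neg h₁, if_neg h₀] at hα
      split_ifs at hα <;> simp at hα
  cwa_complete α h₁ h₂ := by
    have h : α.pred ∈ σ.preds α.arity ∧ IsCWA α.pred := ⟨h₁, h₂⟩
    split_ifs <;> simp
  neg_one_cwa α hα := by
    split_ifs at hα with _ _ h₃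
    · simp at hα
    · simp at hα
    · exact h₃.2

section OfObservations

variable {l : List ℕ}
  (hpred : ∀ (α : Fact) (b : ℕ), Nat.pair α.code b ∈ l → α.pred ∈ σ.preds α.arity)

theorem ofObservations_val_eq_one (α : Fact) :
    (ofObservations σ l hpred).val α = some 1 ↔ Nat.pair α.code 1 ∈ l := by
  simp only [ofObservations]
  split_ifs with h₁ h₀ <;> simp [h₁]

theorem ofObservations_val_eq_zero
    (hcons : ∀ α : Fact, Nat.pair α.code 1 ∈ l → Nat.pair α.code 0 ∉ l) (α : Fact) :
    (ofObservations σ l hpred).val α = some 0 ↔ Nat.pair α.code 0 ∈ l := by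
  simp only [ofObservations]
  split_ifs with h₁ h₀
  · simp [hcons α h₁]
  · simp [h₀]
  · simp [h₀]
  · simp [h₀]

theorem code_ofObservations
    (hcons : ∀ α : Fact, Nat.pair α.code 1 ∈ l → Nat.pair α.code 0 ∉ l) (hsort : l.Pairwise (· < ·))
    (hmem : ∀ x ∈ l, ∃ α : Fact, x = Nat.pair α.code 1 ∨ x = Nat.pair α.code 0) :
    (ofObservations σ l hpred).code = Encodable.encode l := by
  have hmem : ∀ x, x ∈ codedList (ofObservations σ l hpred).code ↔ x ∈ l := by
    intro x
    rw [mem_codedList_code]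
    constructor
    · rintro ⟨α, ⟨hα, rfl⟩ | ⟨hα, rfl⟩⟩
      exacts [(ofObservations_val_eq_one hpred α).1 hα,
        (ofObservations_val_eq_zero hpred hcons α).1 hα]
    · intro hx
      obtain ⟨α, rfl | rfl⟩ := hmem x hx
      exacts [⟨α, Or.inl ⟨(ofObservations_val_eq_one hpred α).2 hx, rfl⟩⟩,
        ⟨α, Or.inr ⟨(ofObservations_val_eq_zero hpred hcons α).2 hx, rfl⟩⟩]
  have hs : (codedList (ofObservations σ l hpred).code).Pairwise (· < ·) := by
    rw [code, codedList_encode]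
    exact (Finset.sortedLT_sort _).pairwise
  have : codedList (ofObservations σ l hpred).code = l :=
    List.Perm.eq_of_pairwise (le := (· < ·)) (fun a b _ _ h₁ h₂ => absurd h₁ h₂.asymm) hs hsort
      ((List.perm_ext_iff_of_nodup hs.nodup hsort.nodup).2 hmem)
  rw [← encode_codedList (ofObservations σ l hpred).code]
  exact congrArg _ this

end OfObservations

/-- Conversely, every list of observations that satisfies the condition is the code of a database;
its symbols belong to the signature because those of `D` do. -/
theorem exists_of_extendsCode {D : Database σ} {δ r : ℕ} (h : ExtendsCode D.code δ r) :
    ∃ D' : Database σ, D'.code = δ ∧ D.Extends (D'.rename (codedPerm r).toEmbedding) ∧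
      (D.IsPositive → D'.IsPositive) := by
  obtain ⟨hsort, hsub, hcwa⟩ := h
  rw [sorted_iff_getD] at hsort
  set τ : Const ↪ Const := (codedPerm r).toEmbedding with hτ
  have sub : ∀ (α : Fact) (b : ℕ), Nat.pair α.code b ∈ codedList δ →
      Nat.pair (α.rename τ).code b ∈ codedList D.code := by
    intro α b hα
    obtain ⟨y, hy, hxy⟩ := hsub _ hα
    rw [← renameCode_pair]
    exact hxy ▸ hy
  have inv : ∀ (x : ℕ) (β : Fact) (b : ℕ), renameCode (codedPerm r) x = Nat.pair β.code b →
      x = Nat.pair (β.rename (codedPerm r).symm.toEmbedding).code b := by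
    intro x β b hx
    rw [← renameCode_pair, ← hx]
    refine Eq.trans ?_ (renameCode_renameCode (codedPerm r) (codedPerm r).symm x).symm
    rw [Equiv.symm_comp_self, renameCode_id]
  have ren_symm : ∀ β : Fact, (β.rename (codedPerm r).symm.toEmbedding).rename τ = β := by
    intro β
    simp [Fact.rename, hτ]
  have mem : ∀ x ∈ codedList δ, ∃ α : Fact, x = Nat.pair α.code 1 ∨ x = Nat.pair α.code 0 := by
    intro x hx
    obtain ⟨y, hy, hxy⟩ := hsub x hx
    obtain ⟨β, ⟨-, rfl⟩ | ⟨-, rfl⟩⟩ := (D.mem_codedList_code y).1 hy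
    · exact ⟨_, Or.inl (inv x β 1 hxy)⟩
    · exact ⟨_, Or.inr (inv x β 0 hxy)⟩
  have hcons : ∀ α : Fact, Nat.pair α.code 1 ∈ codedList δ → Nat.pair α.code 0 ∉ codedList δ := by
    intro α h₁ h₀
    have h := (D.pair_one_mem_iff _).1 (sub α 1 h₁)
    rw [(D.pair_zero_mem_iff _).1 (sub α 0 h₀)] at h
    simp at h
  have hpred : ∀ (α : Fact) (b : ℕ), Nat.pair α.code b ∈ codedList δ →
      α.pred ∈ σ.preds α.arity := by
    intro α b hα
    refine D.isOver (α.rename τ) ?_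
    obtain ⟨β, ⟨h, h'⟩ | ⟨h, h'⟩⟩ := (D.mem_codedList_code _).1 (sub α b hα)
    · rw [Fact.code_injective (Nat.pair_eq_pair.1 h').1, h]; simp
    · rw [Fact.code_injective (Nat.pair_eq_pair.1 h').1, h]; simp
  have val_one := ofObservations_val_eq_one hpred
  have val_zero := ofObservations_val_eq_zero hpred hcons
  have hcode := code_ofObservations hpred hcons hsort mem
  rw [encode_codedList] at hcode
  refine ⟨ofObservations σ (codedList δ) hpred, hcode, ?_, ?_⟩
  · generalize ofObservations σ (codedList δ) hpred = D' at val_one val_zero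
    intro β v hv
    obtain ⟨α, rfl⟩ : ∃ α, Fact.rename τ α = β := ⟨_, ren_symm β⟩
    rw [rename_val_rename] at hv
    rcases v with _ | _ | _
    · exact (D.pair_zero_mem_iff _).1 (sub α 0 ((val_zero α).1 hv))
    -- A CWA-fact that is unobserved in `D'` is unobserved in `D` by the last part of the condition.
    · have hc : IsCWA α.pred := D'.neg_one_cwa α hv
      have hov : α.pred ∈ σ.preds α.arity := D'.isOver α (by rw [hv]; simp)
      obtain ⟨w, hw⟩ := Option.ne_none_iff_exists'.1 (D.cwa_complete (α.rename τ) hov hc)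
      by_cases hw' : w = -1
      · rw [hw, hw']; rfl
      · exfalso
        obtain ⟨b, hb⟩ := D.exists_pair_mem_of_val hw hw'
        obtain ⟨x, hx, hxb⟩ := hcwa _ hb ((isCWACode_pair _ _).2 hc)
        have hxα : x = Nat.pair α.code b := by
          rw [inv x _ b hxb]
          simp [Fact.rename, hτ]
        obtain ⟨γ, hγ⟩ := mem x hx
        rw [hxα] at hγ hx
        rcases hγ with hγ | hγ
        · rw [(Nat.pair_eq_pair.1 hγ).2, ← val_one, hv] at hx
          exact absurd hx (by decide)
        · rw [(Nat.pair_eq_pair.1 hγ).2, ← val_zero, hv] at hx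
          exact absurd hx (by decide)
    · exact (D.pair_one_mem_iff _).1 (sub α 1 ((val_one α).1 hv))
  · intro hpos α hα
    exact hpos _ ((D.pair_zero_mem_iff _).1 (sub α 0 ((val_zero α).1 hα)))

end Database

theorem primrec_extendsCode {α : Type} [Primcodable α] {f g h : α → ℕ} (hf : Primrec f)
    (hg : Primrec g) (hh : Primrec h) : PrimrecPred fun a => ExtendsCode (f a) (g a) (h a) := by
  have ren : ∀ {β : Type} [Primcodable β] {r x : β → ℕ}, Primrec r → Primrec x →
      Primrec fun a => renameCode (codedPerm (r a)) (x a) := by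
    intro β _ r x hr hx
    have hu := Primrec.unpair.comp hx
    have hu' := Primrec.unpair.comp (Primrec.fst.comp hu)
    refine Primrec₂.natPair.comp (Primrec₂.natPair.comp (Primrec.fst.comp hu') ?_)
      (Primrec.snd.comp hu)
    refine Primrec.encode.comp (Primrec.list_map (primrec_codedList.comp (Primrec.snd.comp hu')) ?_)
    exact primrec_codedPerm (hr.comp Primrec.fst) Primrec.snd
  have cwa : PrimrecPred IsCWACode := by
    have h₁ : Primrec fun x : ℕ => x.unpair.1 := Primrec.fst.comp Primrec.unpair
    have h₂ : Primrec fun x : ℕ => x.unpair.2 := Primrec.snd.comp Primrec.unpair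
    exact Primrec.eq.comp (Primrec.nat_mod.comp (h₂.comp (h₁.comp h₁)) (Primrec.const 2))
      (Primrec.const 1)
  have hf' := primrec_codedList.comp hf
  have hg' := primrec_codedList.comp hg
  have getD {β : Type} [Primcodable β] {l : β → List ℕ} {i : β → ℕ} (hl : Primrec l)
      (hi : Primrec i) : Primrec fun b => (l b).getD (i b) 0 := (Primrec.list_getD 0).comp hl hi
  refine PrimrecPred.and ?_ (PrimrecPred.and ?_ ?_)
  · refine PrimrecRel.forall_lt' (p := fun a i => ∀ j < i, (codedList (g a)).getD j 0 <
      (codedList (g a)).getD i 0) (Primrec.list_length.comp hg') ?_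
    refine PrimrecRel.forall_lt' (p := fun (q : α × ℕ) j => (codedList (g q.1)).getD j 0 <
      (codedList (g q.1)).getD q.2 0) Primrec.snd ?_
    have hg'' : Primrec fun q : (α × ℕ) × ℕ => codedList (g q.1.1) :=
      hg'.comp (Primrec.fst.comp Primrec.fst)
    exact Primrec.nat_lt.comp (getD hg'' Primrec.snd) (getD hg'' (Primrec.snd.comp Primrec.fst))
  · refine PrimrecRel.forall_mem (p := fun a x => ∃ y ∈ codedList (f a),
      renameCode (codedPerm (h a)) x = y) hg' ?_
    refine PrimrecRel.exists_mem (p := fun (q : α × ℕ) y => renameCode (codedPerm (h q.1)) q.2 = y)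
      (hf'.comp Primrec.fst) ?_
    exact Primrec.eq.comp (ren (hh.comp (Primrec.fst.comp Primrec.fst))
      (Primrec.snd.comp Primrec.fst)) Primrec.snd
  · refine (PrimrecRel.forall_mem (p := fun a y => ¬ IsCWACode y ∨ ∃ x ∈ codedList (g a),
      renameCode (codedPerm (h a)) x = y) hf' ?_).of_eq fun a => by simp only [imp_iff_not_or]
    refine PrimrecPred.or (PrimrecPred.not (cwa.comp Primrec.snd)) ?_
    refine PrimrecRel.exists_mem (p := fun (q : α × ℕ) x => renameCode (codedPerm (h q.1)) x = q.2)
      (hg'.comp Primrec.fst) ?_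
    exact Primrec.eq.comp (ren (hh.comp (Primrec.fst.comp Primrec.fst)) Primrec.snd)
      (Primrec.snd.comp Primrec.fst)

/-! ### The canonical formalism -/

theorem primrec_bits : Primrec Nat.bits := by
  -- Strong recursion: `l` lists the values at all smaller numbers.
  have hg : Primrec₂ fun (_ : Unit) (l : List (List Bool)) =>
      if l.length = 0 then some [] else
        (l[l.length / 2]?).map fun t => (l.length.bodd :: t : List Bool) := by
    have hlen : Primrec fun p : Unit × List (List Bool) => p.2.length :=
      Primrec.list_length.comp Primrec.snd
    refine Primrec.ite (Primrec.eq.comp hlen (Primrec.const 0)) (Primrec.const _) ?_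
    refine Primrec.option_map (Primrec.list_getElem?.comp Primrec.snd
      (Primrec.nat_div.comp hlen (Primrec.const 2))) ?_
    exact Primrec.list_cons.comp (Primrec.nat_bodd.comp (hlen.comp Primrec.fst)) Primrec.snd
  refine (Primrec.nat_strong_rec (fun (_ : Unit) n => Nat.bits n) hg fun _ n => ?_).comp
    (Primrec.const ()) Primrec.id
  rcases Nat.eq_zero_or_pos n with rfl | hn
  · simp
  · have hlt : n / 2 < n := Nat.div_lt_self hn one_lt_two
    have hb : n.bits = n.bodd :: (n / 2).bits := by
      conv_lhs => rw [← Nat.bit_bodd_div2 n]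
      rw [Nat.bits_append_bit, Nat.div2_val]
      intro h
      rw [Nat.div2_val] at h
      have := Nat.div_add_mod n 2
      rw [Nat.mod_two_of_bodd] at this
      cases hbo : n.bodd
      · simp [h, hbo] at this; omega
      · rfl
    simp [hn.ne', hlt, hb]

theorem primrec_machineString : Primrec machineString := primrec_bits.comp Primrec.encode

/-- The program described by a string: the inverse of `machineString`. -/
def decodeMachine (l : List Bool) : Nat.Partrec.Code :=
  Denumerable.ofNat Nat.Partrec.Code (l.foldr (fun b n => 2 * n + b.toNat) 0)

theorem primrec_decodeMachine : Primrec decodeMachine := by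
  have hbit : Primrec₂ fun (b : Bool) (n : ℕ) => 2 * n + b.toNat :=
    Primrec.nat_add.comp (Primrec.nat_mul.comp (Primrec.const 2) Primrec.snd)
      ((Primrec.dom_finite Bool.toNat).comp Primrec.fst)
  exact (Primrec.ofNat _).comp (Primrec.list_foldr Primrec.id (Primrec.const 0)
    (hbit.comp (Primrec.fst.comp Primrec.snd) (Primrec.snd.comp Primrec.snd)).to₂)

theorem decodeMachine_machineString (M : Nat.Partrec.Code) :
    decodeMachine (machineString M) = M := by
  have key : ∀ n : ℕ, n.bits.foldr (fun b n => 2 * n + b.toNat) 0 = n := by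
    intro n
    induction n using Nat.binaryRec' with
    | zero => simp
    | bit b n h ih =>
      rw [Nat.bits_append_bit n b h, List.foldr_cons, ih]
      cases b <;> simp [Nat.bit]
  rw [decodeMachine, machineString, key, Denumerable.ofNat_encode]

theorem machineString_injective : Function.Injective machineString :=
  Function.LeftInverse.injective decodeMachine_machineString

section Theta

variable {σ : Signature} {𝒟 : Set (Database σ)} {𝒬 : Set Sentence}

theorem theta_machineString (M : Nat.Partrec.Code) :
    Theta 𝒟 𝒬 (machineString M) = Part.some (closure 𝒟 𝒬 (accepted 𝒟 𝒬 M)) := by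
  have h : ∃ M', machineString M' = machineString M := ⟨M, rfl⟩
  refine Part.ext' (iff_of_true h trivial) fun h₁ _ => ?_
  change closure 𝒟 𝒬 (accepted 𝒟 𝒬 (Exists.choose h₁)) = _
  rw [machineString_injective (Exists.choose_spec h₁)]
  rfl

theorem accepted_subset (M : Nat.Partrec.Code) : accepted 𝒟 𝒬 M ⊆ 𝒟 ×ˢ 𝒬 := fun _ hx => hx.1

theorem computablePred_theta_dom : ComputablePred fun π => π ∈ (Theta 𝒟 𝒬).Dom := by
  refine (PrimrecPred.computablePred (p := fun π => machineString (decodeMachine π) = π)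
    (Primrec.eq.comp (primrec_machineString.comp primrec_decodeMachine) Primrec.id)).of_eq
      fun π => ⟨fun h => ⟨_, h⟩, ?_⟩
  rintro ⟨M, rfl⟩
  rw [decodeMachine_machineString]

/-- The condition for `(k, n, L)` to certify that the sentence with code `q` follows, at the
database with code `d`, from the pairs accepted by `M`. Each triple `(δ, m, r)` in the list `L`
stands for a pair of codes `(δ, m)` that `M` accepts within `k` steps, where the program `cQ`
confirms that `m` is the code of a query, together with a renaming `r`. The number `n` bounds the
propositional refutation that replaces a formal proof of the sentence. -/
def IsCertificate (cQ M : Nat.Partrec.Code) (d q : ℕ) (c : ℕ × ℕ × List (ℕ × ℕ × ℕ)) : Prop :=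
  (∀ x ∈ c.2.2, HaltsWithin c.1 M (Nat.pair x.1 x.2.1) ∧ HaltsWithin c.1 cQ x.2.1 ∧
    ExtendsCode d x.1 x.2.2) ∧
  RefutedAt c.2.1 tarskiFamily (entailmentLits (c.2.2.map Prod.snd) q)

theorem rePred_exists_isCertificate (cQ : Nat.Partrec.Code) :
    REPred fun x : List Bool × ℕ × ℕ =>
      ∃ c, IsCertificate cQ (decodeMachine x.1) x.2.1 x.2.2 c := by
  refine PrimrecRel.rePred_exists (p := fun (x : List Bool × ℕ × ℕ) c =>
    IsCertificate cQ (decodeMachine x.1) x.2.1 x.2.2 c) ?_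
  have hL : Primrec fun p : (List Bool × ℕ × ℕ) × (ℕ × ℕ × List (ℕ × ℕ × ℕ)) => p.2.2.2 :=
    Primrec.snd.comp (Primrec.snd.comp Primrec.snd)
  refine PrimrecPred.and ?_ ?_
  · refine PrimrecRel.forall_mem
      (p := fun (p : (List Bool × ℕ × ℕ) × (ℕ × ℕ × List (ℕ × ℕ × ℕ))) (x : ℕ × ℕ × ℕ) =>
        HaltsWithin p.2.1 (decodeMachine p.1.1) (Nat.pair x.1 x.2.1) ∧
          HaltsWithin p.2.1 cQ x.2.1 ∧ ExtendsCode p.1.2.1 x.1 x.2.2) hL ?_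
    have hp : Primrec fun z : ((List Bool × ℕ × ℕ) × (ℕ × ℕ × List (ℕ × ℕ × ℕ))) × (ℕ × ℕ × ℕ) =>
      z.1 := Primrec.fst
    have hx : Primrec fun z : ((List Bool × ℕ × ℕ) × (ℕ × ℕ × List (ℕ × ℕ × ℕ))) × (ℕ × ℕ × ℕ) =>
      z.2 := Primrec.snd
    have hx₁ := Primrec.fst.comp hx
    have hx₂ := Primrec.fst.comp (Primrec.snd.comp hx)
    have hx₃ := Primrec.snd.comp (Primrec.snd.comp hx)
    have hk := Primrec.fst.comp (Primrec.snd.comp hp)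
    have hπ := Primrec.fst.comp (Primrec.fst.comp hp)
    have hd := Primrec.fst.comp (Primrec.snd.comp (Primrec.fst.comp hp))
    exact (primrec_haltsWithin hk (primrec_decodeMachine.comp hπ)
      (Primrec₂.natPair.comp hx₁ hx₂)).and
      ((primrec_haltsWithin hk (Primrec.const cQ) hx₂).and (primrec_extendsCode hd hx₁ hx₃))
  · exact primrec_refutedAt (Primrec.fst.comp (Primrec.snd.comp Primrec.snd)) primrec_tarskiFamily
      (primrec_entailmentLits (Primrec.list_map hL (Primrec.snd.comp Primrec.snd).to₂)
        (Primrec.snd.comp (Primrec.snd.comp Primrec.fst)))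

theorem exists_forall_mem_of_mono {α : Type*} {P : ℕ → α → Prop}
    (hP : ∀ k l x, k ≤ l → P k x → P l x) (L : List α) (h : ∀ x ∈ L, ∃ k, P k x) :
    ∃ k, ∀ x ∈ L, P k x := by
  induction L with
  | nil => exact ⟨0, by simp⟩
  | cons a L ih =>
    obtain ⟨k, hk⟩ := ih fun x hx => h x (List.mem_cons_of_mem _ hx)
    obtain ⟨l, hl⟩ := h a (by simp)
    refine ⟨max k l, fun x hx => ?_⟩
    rcases List.mem_cons.1 hx with rfl | hx
    · exact hP _ _ _ (le_max_right _ _) hl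
    · exact hP _ _ _ (le_max_left _ _) (hk x hx)

/-- Certificates characterize the closure of what a program accepts. Finite permutations suffice as
renamings, since only finitely many constants matter; and no condition on the signature or on
positivity has to be verified, as `ExtendsCode` transfers it from `D`. -/
theorem exists_isCertificate_iff (h𝒟 : 𝒟 = allDatabases σ ∨ 𝒟 = positiveDatabases σ)
    {cQ : Nat.Partrec.Code}
    (hcQ : ∀ m, (cQ.eval m).Dom ↔ ∃ φ ∈ 𝒬, sentenceCode φ = m) (M : Nat.Partrec.Code)
    {D : Database σ} (hD : D ∈ 𝒟) (φ : Sentence) :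
    (∃ c, IsCertificate cQ M D.code (sentenceCode φ) c) ↔
      FollowsFrom (accepted 𝒟 𝒬 M) D φ := by
  constructor
  · rintro ⟨⟨k, n, L⟩, hL, hn⟩
    have hex : ∀ x ∈ L, ∃ y : Database σ × Sentence, y ∈ accepted 𝒟 𝒬 M ∧
        D.Extends (y.1.rename (codedPerm x.2.2).toEmbedding) ∧ sentenceCode y.2 = x.2.1 := by
      intro x hx
      obtain ⟨hM, hQ, hE⟩ := hL x hx
      obtain ⟨D', hcode, hext, hpos⟩ := Database.exists_of_extendsCode hE
      obtain ⟨ψ, hψ, hψc⟩ := (hcQ _).1 ((eval_dom_iff _ _).2 ⟨_, hQ⟩)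
      have hD' : D' ∈ 𝒟 := by
        rcases h𝒟 with rfl | rfl
        · exact Set.mem_univ _
        · exact hpos hD
      refine ⟨(D', ψ), ⟨⟨hD', hψ⟩, ?_⟩, hext, hψc⟩
      rw [hcode, hψc]
      exact (eval_dom_iff _ _).2 ⟨_, hM⟩
    have : Nonempty (Database σ × Sentence) := ⟨(D, φ)⟩
    choose! F hF using hex
    refine ⟨L.map fun x => ((F x).1, (F x).2, (codedPerm x.2.2).toEmbedding), ?_, ?_⟩
    · intro y hy
      obtain ⟨x, hx, rfl⟩ := List.mem_map.1 hy
      exact ⟨(hF x hx).1, (hF x hx).2.1⟩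
    · have hlits : L.map Prod.snd =
          (L.map fun x => ((F x).2, x.2.2)).map fun x => (sentenceCode x.1, x.2) := by
        rw [List.map_map]
        exact List.map_congr_left fun x hx => by simp [(hF x hx).2.2]
      have hn : Refuted tarskiFamily (entailmentLits (L.map Prod.snd) (sentenceCode φ)) := ⟨n, hn⟩
      rw [hlits, refuted_entailmentLits_iff] at hn
      refine hn.mono ?_
      rintro _ ⟨_, hy, rfl⟩
      obtain ⟨x, hx, rfl⟩ := List.mem_map.1 hy
      exact ⟨_, List.mem_map.2 ⟨x, hx, rfl⟩, rfl⟩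
  · rintro ⟨l, hl, hent⟩
    have hex : ∀ x ∈ l, ∃ r, ExtendsCode D.code x.1.code r ∧
        renameSentence (codedPerm r).toEmbedding x.2.1 = renameSentence x.2.2 x.2.1 := by
      intro x hx
      obtain ⟨N₁, h₁⟩ := Database.exists_extendsCode_of_extends (hl x hx).2
      obtain ⟨N₂, h₂⟩ := exists_renameSentence_congr x.2.1
      obtain ⟨r, hr⟩ := exists_codedPerm_eqOn x.2.2 (max N₁ N₂)
      exact ⟨r, h₁ r fun c hc => hr c (hc.trans_le (le_max_left _ _)),
        h₂ _ _ fun c hc => hr c (hc.trans_le (le_max_right _ _))⟩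
    choose! r hr using hex
    obtain ⟨k, hk⟩ := exists_forall_mem_of_mono
      (P := fun k (x : Database σ × Sentence × (Const ↪ Const)) =>
        HaltsWithin k M (Nat.pair x.1.code (sentenceCode x.2.1)) ∧
          HaltsWithin k cQ (sentenceCode x.2.1))
      (fun k l x hkl h => ⟨h.1.mono hkl, h.2.mono hkl⟩) l (fun x hx => by
        obtain ⟨⟨-, hψ⟩, hM⟩ := (hl x hx).1
        obtain ⟨k₁, h₁⟩ := (eval_dom_iff _ _).1 hM
        obtain ⟨k₂, h₂⟩ := (eval_dom_iff _ _).1 ((hcQ _).2 ⟨_, hψ, rfl⟩)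
        exact ⟨max k₁ k₂, h₁.mono (le_max_left _ _), h₂.mono (le_max_right _ _)⟩)
    have href : Refuted tarskiFamily (entailmentLits
        ((l.map fun x => (x.2.1, r x)).map fun x => (sentenceCode x.1, x.2)) (sentenceCode φ)) := by
      rw [refuted_entailmentLits_iff]
      refine hent.mono ?_
      rintro _ ⟨x, hx, rfl⟩
      exact ⟨_, List.mem_map.2 ⟨x, hx, rfl⟩, (hr x hx).2⟩
    obtain ⟨n, hn⟩ := href
    refine ⟨(k, n, l.map fun x => (x.1.code, sentenceCode x.2.1, r x)), ?_, ?_⟩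
    · intro y hy
      obtain ⟨x, hx, rfl⟩ := List.mem_map.1 hy
      exact ⟨(hk x hx).1, (hk x hx).2, (hr x hx).1⟩
    · simpa only [List.map_map, Function.comp_def] using hn

theorem rename_mem (h𝒟 : 𝒟 = allDatabases σ ∨ 𝒟 = positiveDatabases σ) :
    ∀ D ∈ 𝒟, ∀ τ, D.rename τ ∈ 𝒟 := by
  rcases h𝒟 with rfl | rfl
  · exact fun _ _ _ => Set.mem_univ _
  · exact fun D hD τ => Database.IsPositive.rename hD τ

theorem isKRF_theta {σQ : Signature} (h𝒟 : 𝒟 = allDatabases σ ∨ 𝒟 = positiveDatabases σ)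
    (h𝒬 : IsQueryLanguage σQ 𝒬) : IsKRF 𝒟 𝒬 (Theta 𝒟 𝒬) where
  dom_recursive := computablePred_theta_dom
  isKB := by
    rintro π K hK
    obtain ⟨M, rfl⟩ : π ∈ (Theta 𝒟 𝒬).Dom := Part.dom_iff_mem.2 ⟨K, hK⟩
    rw [theta_machineString, Part.mem_some_iff] at hK
    rw [hK]
    exact isKB_closure h𝒬 (rename_mem h𝒟) (accepted_subset M)
  re := by
    obtain ⟨cQ, hcQ⟩ := h𝒬.recursive.to_re.exists_code
    refine ⟨_, rePred_exists_isCertificate cQ, ?_⟩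
    rintro π K hK D hD φ hφ
    obtain ⟨M, rfl⟩ : π ∈ (Theta 𝒟 𝒬).Dom := Part.dom_iff_mem.2 ⟨K, hK⟩
    rw [theta_machineString, Part.mem_some_iff] at hK
    rw [hK, closure_eq_followsFrom h𝒬 (rename_mem h𝒟) (accepted_subset M),
      decodeMachine_machineString, exists_isCertificate_iff h𝒟 hcQ M hD]
    exact ⟨fun h => ⟨⟨hD, hφ⟩, h⟩, fun h => h.2⟩

/-- The restriction of a computable function to a recursive set. -/
def restrictDom (P : List Bool → Prop) (f : List Bool → List Bool) : List Bool →. List Bool :=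
  fun π => ⟨P π, fun _ => f π⟩

theorem isRecursive_restrictDom {P : List Bool → Prop} {f : List Bool → List Bool}
    (hP : ComputablePred P) (hf : Computable f) : IsRecursive (restrictDom P f) := by
  refine ⟨?_, hP⟩
  obtain ⟨g, hg, rfl⟩ := ComputablePred.computable_iff.1 hP
  refine (Partrec.cond hg hf.partrec Partrec.none).of_eq fun π => ?_
  refine Part.ext fun x => ?_
  cases h : g π <;> simp [restrictDom, h, Part.mem_mk_iff, eq_comm]

theorem isReduction_restrictDom {Γ Γ₀ : Formalism σ} (hΓ : ComputablePred fun π => π ∈ Γ.Dom)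
    {f : List Bool → List Bool} (hf : Computable f) (h : ∀ π ∈ Γ.Dom, Γ₀ (f π) = Γ π) :
    IsReduction Γ Γ₀ (restrictDom (· ∈ Γ.Dom) f) where
  recursive := isRecursive_restrictDom hΓ hf
  dom_eq := rfl
  ran_subset := by
    rintro _ ⟨π, hπ, rfl⟩
    change (Γ₀ (f π)).Dom
    rw [h π hπ]
    exact hπ
  comp_eq := by
    funext π
    by_cases hπ : π ∈ Γ.Dom
    · have : restrictDom (· ∈ Γ.Dom) f π = Part.some (f π) :=
        Part.ext' (iff_of_true hπ trivial) fun _ _ => rfl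
      rw [PFun.comp_apply, this]
      exact ((Part.bind_some _ _).trans (h π hπ)).symm
    · refine Part.ext' (iff_of_false hπ ?_) fun h => absurd h hπ
      rw [PFun.comp_apply]
      exact fun ⟨h, _⟩ => hπ h

/-- The canonical formalism is universal: a program that accepts the members of all `Γ π` turns each
theory `π` into a program that accepts exactly `Γ π`, and `Γ π` is its own closure. -/
theorem isUniversalKRF_theta {σQ : Signature} (h𝒟 : 𝒟 = allDatabases σ ∨ 𝒟 = positiveDatabases σ)
    (h𝒬 : IsQueryLanguage σQ 𝒬) : IsUniversalKRF 𝒟 𝒬 (Theta 𝒟 𝒬) := by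
  refine ⟨isKRF_theta h𝒟 h𝒬, fun Γ hΓ => ?_⟩
  obtain ⟨R, hR, hRΓ⟩ := hΓ.re
  obtain ⟨c, hc⟩ := hR.exists_code
  have hf : Computable fun π : List Bool => machineString (c.curry (Encodable.encode π)) :=
    (primrec_machineString.comp
      (Nat.Partrec.Code.primrec₂_curry.comp (Primrec.const c) Primrec.encode)).to_comp
  refine ⟨_, isReduction_restrictDom hΓ.dom_recursive hf fun π hπ => ?_⟩
  obtain ⟨K, hK⟩ := Part.dom_iff_mem.1 hπ
  have hKB := hΓ.isKB π K hK
  rw [theta_machineString, Part.eq_some_iff.2 hK]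
  have : accepted 𝒟 𝒬 (c.curry (Encodable.encode π)) = K := by
    ext ⟨D, φ⟩
    have hiff : (Nat.Partrec.Code.eval (c.curry (Encodable.encode π))
        (Nat.pair D.code (sentenceCode φ))).Dom ↔ R (π, D.code, sentenceCode φ) := by
      rw [Nat.Partrec.Code.eval_curry, ← hc]
      rfl
    constructor
    · rintro ⟨⟨hD, hφ⟩, h⟩
      exact (hRΓ π K hK D hD φ hφ).1 (hiff.1 h)
    · intro h
      obtain ⟨hD, hφ⟩ := hKB.subset h
      exact ⟨⟨hD, hφ⟩, hiff.2 ((hRΓ π K hK D hD φ hφ).2 h)⟩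
  rw [this, hKB.closure_eq]

end Theta

/-! ### Padding -/

section Padding

variable {σ : Signature} {𝒟 : Set (Database σ)} {𝒬 : Set Sentence}

theorem Reducible.exists_computable {Γ Γ₀ : Formalism σ} (h : Reducible Γ Γ₀) :
    ∃ f : List Bool → List Bool, Computable f ∧ ∀ π ∈ Γ.Dom, Γ₀ (f π) = Γ π := by
  classical
  obtain ⟨p, ⟨hp, hdom⟩, hpdom, -, hcomp⟩ := h
  refine ⟨fun π => if h : (p π).Dom then (p π).get h else [], ?_, fun π hπ => ?_⟩
  · refine Partrec.of_eq_tot (f := fun π => bif decide (π ∈ p.Dom) then p π else Part.some [])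
      (Partrec.cond hdom.decide hp (Computable.const []).partrec) fun π => ?_
    by_cases hπ : (p π).Dom
    · have hπ' : π ∈ p.Dom := hπ
      simp only [hπ', decide_true, cond_true, dif_pos hπ]
      exact Part.get_mem hπ
    · have hπ' : π ∉ p.Dom := hπ
      simp only [hπ', decide_false, cond_false, dif_neg hπ]
      exact Part.mem_some _
  · have hπ' : (p π).Dom := by
      have : π ∈ p.Dom := hpdom ▸ hπ
      exact this
    have hval : p π = Part.some ((p π).get hπ') := (Part.some_get hπ').symm
    simp only [dif_pos hπ']
    rw [hcomp, PFun.comp_apply]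
    conv_rhs => rw [hval]
    exact (Part.bind_some _ _).symm

/-- The database in which nothing is observed. -/
noncomputable def emptyDatabase (σ : Signature) : Database σ :=
  Database.ofObservations σ [] (by simp)

theorem emptyDatabase_isPositive : (emptyDatabase σ).IsPositive := fun α h => by
  rw [emptyDatabase, Database.ofObservations_val_eq_zero _ (by simp)] at h
  simp at h

/-- The least knowledge base differs from the greatest one: some query is not a tautology, hence it
does not hold at the empty database in the least one. -/
theorem closure_empty_ne {σQ : Signature} (h𝒟 : 𝒟 = allDatabases σ ∨ 𝒟 = positiveDatabases σ)
    (h𝒬 : IsQueryLanguage σQ 𝒬) : closure 𝒟 𝒬 ∅ ≠ closure 𝒟 𝒬 (𝒟 ×ˢ 𝒬) := by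
  obtain ⟨φ, hφ, htaut⟩ := h𝒬.exists_not_tautology
  have hD : emptyDatabase σ ∈ 𝒟 := by
    rcases h𝒟 with rfl | rfl
    exacts [Set.mem_univ _, emptyDatabase_isPositive]
  intro h
  have hmem : (emptyDatabase σ, φ) ∈ closure 𝒟 𝒬 (𝒟 ×ˢ 𝒬) := subset_closure _ ⟨hD, hφ⟩
  rw [← h, closure_eq_followsFrom h𝒬 (rename_mem h𝒟) (Set.empty_subset _)] at hmem
  obtain ⟨-, l, hl, hent⟩ := hmem
  refine htaut ((isTautology_iff φ).2 (hent.mono ?_))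
  rintro _ ⟨x, hx, -⟩
  exact absurd (hl x hx).1 (Set.notMem_empty _)

theorem computable_list_mem : Computable₂ fun (x : List Bool) (S : List (List Bool)) =>
    decide (x ∈ S) := by
  have h : PrimrecRel fun (x : List Bool) (S : List (List Bool)) => x ∈ S := by
    refine (PrimrecRel.exists_mem (p := fun (q : List Bool × List (List Bool)) y => y = q.1)
      Primrec.snd (Primrec.eq.comp Primrec.snd (Primrec.fst.comp Primrec.fst))).of_eq fun q => ?_
    simp
  exact h.decide.to_comp

/-- A program that refers to its own description: given a computable map `G` of programs to strings
and a computable map `F` of strings to programs, `M π S` behaves like `F π`, unless its own image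
`G (M π S)` belongs to the list `S`, in which case it accepts everything or nothing, as prescribed
by `b`. This is an instance of the recursion theorem. -/
theorem exists_selfReferential {F : List Bool → Nat.Partrec.Code} {G : Nat.Partrec.Code → List Bool}
    (hF : Computable F) (hG : Computable G) (b : Bool) :
    ∃ M : List Bool × List (List Bool) → Nat.Partrec.Code, Computable M ∧ ∀ y,
      (G (M y) ∈ y.2 → ∀ z, ((M y).eval z).Dom ↔ b = true) ∧
        (G (M y) ∉ y.2 → (M y).eval = (F y.1).eval) := by
  let dec : ℕ → List Bool × List (List Bool) := fun n => (Encodable.decode n).getD default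
  have hdec : Computable dec := Computable.option_getD Computable.decode (Computable.const _)
  let behaviour : Nat.Partrec.Code → ℕ →. ℕ := fun e x =>
    bif decide (G (e.curry x.unpair.1) ∈ (dec x.unpair.1).2) then
      (bif b then Part.some 0 else Part.none)
    else (F (dec x.unpair.1).1).eval x.unpair.2
  have hb : Partrec₂ behaviour := by
    have hx₁ : Computable fun p : Nat.Partrec.Code × ℕ => p.2.unpair.1 :=
      Computable.fst.comp (Computable.unpair.comp Computable.snd)
    have hx₂ : Computable fun p : Nat.Partrec.Code × ℕ => p.2.unpair.2 :=
      Computable.snd.comp (Computable.unpair.comp Computable.snd)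
    have hy := hdec.comp hx₁
    refine Partrec.cond (computable_list_mem.comp (hG.comp
      (Nat.Partrec.Code.primrec₂_curry.to_comp.comp Computable.fst hx₁))
      (Computable.snd.comp hy)) ?_ ?_
    · cases b
      · exact Partrec.none
      · exact (Computable.const 0).partrec
    · exact Nat.Partrec.Code.eval_part.comp (hF.comp (Computable.fst.comp hy)) hx₂
  obtain ⟨c, hc⟩ := Nat.Partrec.Code.fixed_point₂ hb
  refine ⟨fun y => c.curry (Encodable.encode y),
    Nat.Partrec.Code.primrec₂_curry.to_comp.comp (Computable.const c) Computable.encode,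
    fun y => ?_⟩
  have heval : ∀ z, (c.curry (Encodable.encode y)).eval z =
      bif decide (G (c.curry (Encodable.encode y)) ∈ y.2) then
        (bif b then Part.some 0 else Part.none)
      else (F y.1).eval z := by
    intro z
    rw [Nat.Partrec.Code.eval_curry, hc]
    simp only [behaviour, dec, Nat.unpair_pair, Encodable.encodek, Option.getD_some]
  refine ⟨fun h z => ?_, fun h => funext fun z => ?_⟩
  · rw [heval, decide_eq_true h]
    cases b <;> simp
  · rw [heval, decide_eq_false h]
    rfl

theorem accepted_congr {M M' : Nat.Partrec.Code} (h : M.eval = M'.eval) :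
    accepted 𝒟 𝒬 M = accepted 𝒟 𝒬 M' := by
  rw [accepted, accepted, h]

/-- Padding: in a universal formalism, one can compute from a theory and a list of theories with the
same meaning a further theory with this meaning. -/
theorem IsUniversalKRF.exists_pad {σQ : Signature}
    (h𝒟 : 𝒟 = allDatabases σ ∨ 𝒟 = positiveDatabases σ) (h𝒬 : IsQueryLanguage σQ 𝒬)
    {Γ : Formalism σ} (hΓ : IsUniversalKRF 𝒟 𝒬 Γ) :
    ∃ pad : List Bool × List (List Bool) → List Bool, Computable pad ∧
      ∀ π ∈ Γ.Dom, ∀ S : List (List Bool), (∀ s ∈ S, Γ s = Γ π) →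
        pad (π, S) ∉ S ∧ Γ (pad (π, S)) = Γ π := by
  have hΘ : IsUniversalKRF 𝒟 𝒬 (Theta 𝒟 𝒬) := isUniversalKRF_theta h𝒟 h𝒬
  obtain ⟨f, hf, hfΓ⟩ := (hΘ.2 Γ hΓ.1).exists_computable
  obtain ⟨g, hg, hgΘ⟩ := (hΓ.2 _ hΘ.1).exists_computable
  have hF : Computable (decodeMachine ∘ f) := primrec_decodeMachine.to_comp.comp hf
  have hG : Computable (g ∘ machineString) := hg.comp primrec_machineString.to_comp
  have hFΓ : ∀ π ∈ Γ.Dom, Γ π = Part.some (closure 𝒟 𝒬 (accepted 𝒟 𝒬 (decodeMachine (f π)))) := by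
    intro π hπ
    rw [← hfΓ π hπ]
    have : (Theta 𝒟 𝒬 (f π)).Dom := by
      rw [hfΓ π hπ]
      exact hπ
    obtain ⟨M, hM⟩ := this
    rw [← hM, theta_machineString, decodeMachine_machineString]
  have hGΓ : ∀ M, Γ (g (machineString M)) = Part.some (closure 𝒟 𝒬 (accepted 𝒟 𝒬 M)) := by
    intro M
    rw [← theta_machineString]
    exact hgΘ _ ⟨M, rfl⟩
  obtain ⟨M₀, hM₀, hM₀'⟩ := exists_selfReferential hF hG false
  obtain ⟨M₁, hM₁, hM₁'⟩ := exists_selfReferential hF hG true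
  -- If the image of the program `M₀ y`, which accepts nothing when caught in `S`, lies in `S`, then
  -- the common meaning of the theories is the least knowledge base; for the program `M₁ y`, which
  -- accepts everything when caught, it is the greatest one. So at least one of the two escapes.
  refine ⟨fun y => bif decide (g (machineString (M₀ y)) ∈ y.2) then g (machineString (M₁ y))
    else g (machineString (M₀ y)), ?_, fun π hπ S hS => ?_⟩
  · exact Computable.cond (computable_list_mem.comp (hG.comp hM₀) Computable.snd) (hG.comp hM₁)
      (hG.comp hM₀)
  · have h₀ := hM₀' (π, S)
    have h₁ := hM₁' (π, S)
    simp only [Function.comp_apply] at h₀ h₁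
    by_cases hm₀ : g (machineString (M₀ (π, S))) ∈ S
    · have e₀ : Γ π = Part.some (closure 𝒟 𝒬 ∅) := by
        rw [← hS _ hm₀, hGΓ]
        congr 2
        exact Set.eq_empty_of_forall_notMem fun x hx =>
          Bool.false_ne_true ((h₀.1 hm₀ _).1 hx.2)
      by_cases hm₁ : g (machineString (M₁ (π, S))) ∈ S
      · have e₁ : Γ π = Part.some (closure 𝒟 𝒬 (𝒟 ×ˢ 𝒬)) := by
          rw [← hS _ hm₁, hGΓ]
          congr 2
          exact Set.Subset.antisymm (fun x hx => hx.1) fun x hx => ⟨hx, (h₁.1 hm₁ _).2 trivial⟩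
        exact absurd (Part.some_injective (e₀.symm.trans e₁)) (closure_empty_ne h𝒟 h𝒬)
      · simp only [hm₀, decide_true, cond_true]
        exact ⟨hm₁, by rw [hGΓ, accepted_congr (h₁.2 hm₁), hFΓ π hπ]⟩
    · simp only [decide_eq_false hm₀, cond_false]
      exact ⟨hm₀, by rw [hGΓ, accepted_congr (h₀.2 hm₀), hFΓ π hπ]⟩

/-- Between universal formalisms one can translate a theory in such a way that any given finite list
of theories is avoided. -/
theorem IsUniversalKRF.exists_fresh {σQ : Signature}
    (h𝒟 : 𝒟 = allDatabases σ ∨ 𝒟 = positiveDatabases σ) (h𝒬 : IsQueryLanguage σQ 𝒬)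
    {Γ Γ₀ : Formalism σ} (hΓ : IsUniversalKRF 𝒟 𝒬 Γ) (hΓ₀ : IsUniversalKRF 𝒟 𝒬 Γ₀) :
    ∃ u : List Bool × List (List Bool) → List Bool, Computable u ∧
      ∀ π ∈ Γ.Dom, ∀ S, u (π, S) ∉ S ∧ Γ₀ (u (π, S)) = Γ π := by
  obtain ⟨f, hf, hfΓ⟩ := (hΓ₀.2 Γ hΓ.1).exists_computable
  obtain ⟨pad, hpad, hpadΓ⟩ := hΓ₀.exists_pad h𝒟 h𝒬
  -- `pads π k` lists `k + 1` different theories with the meaning of `π`.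
  let pads : List Bool → ℕ → List (List Bool) := fun π k =>
    Nat.rec [f π] (fun _ P => pad (f π, P) :: P) k
  have hpads : Computable₂ pads := by
    refine Computable.nat_rec (f := fun q : List Bool × ℕ => q.2) (g := fun q => [f q.1])
      (h := fun q p => pad (f q.1, p.2) :: p.2) Computable.snd ?_ ?_
    · exact Computable.list_cons.comp (hf.comp Computable.fst) (Computable.const [])
    · have hP : Computable fun z : (List Bool × ℕ) × (ℕ × List (List Bool)) => z.2.2 :=
        Computable.snd.comp Computable.snd
      exact Computable.list_cons.comp (hpad.comp
        ((hf.comp (Computable.fst.comp Computable.fst)).pair hP)) hP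
  -- Among `S.length + 1` different theories, the first one outside `S` is taken.
  have hfilter : Primrec₂ fun (P S : List (List Bool)) => P.filter fun x => decide (x ∉ S) := by
    have h : PrimrecRel fun (x : List Bool) (S : List (List Bool)) => x ∉ S := by
      refine (PrimrecRel.forall_mem (p := fun (q : List Bool × List (List Bool)) y => ¬ y = q.1)
        Primrec.snd (PrimrecPred.not
          (Primrec.eq.comp Primrec.snd (Primrec.fst.comp Primrec.fst)))).of_eq fun q => ?_
      exact ⟨fun h hq => h _ hq rfl, fun h y hy hyq => h (hyq ▸ hy)⟩
    exact h.listFilter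
  have hspec : ∀ π ∈ Γ.Dom, ∀ k, (pads π k).Nodup ∧ (pads π k).length = k + 1 ∧
      ∀ s ∈ pads π k, Γ₀ s = Γ π := by
    intro π hπ k
    have hdom : f π ∈ Γ₀.Dom := by
      change (Γ₀ (f π)).Dom
      rw [hfΓ π hπ]
      exact hπ
    induction k with
    | zero =>
      refine ⟨List.nodup_singleton _, rfl, fun s hs => ?_⟩
      rw [List.mem_singleton.1 hs, hfΓ π hπ]
    | succ k ih =>
      obtain ⟨h₁, h₂, h₃⟩ := ih
      have := hpadΓ (f π) hdom (pads π k) fun s hs => (h₃ s hs).trans (hfΓ π hπ).symm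
      refine ⟨List.nodup_cons.2 ⟨this.1, h₁⟩, congrArg Nat.succ h₂, fun s hs => ?_⟩
      rcases List.mem_cons.1 hs with rfl | hs
      · exact this.2.trans (hfΓ π hπ)
      · exact h₃ s hs
  refine ⟨fun y => (((pads y.1 y.2.length).filter fun x => decide (x ∉ y.2)).head?).getD [], ?_,
    fun π hπ S => ?_⟩
  · exact Computable.option_getD (Primrec.list_head?.to_comp.comp (hfilter.to_comp.comp
      (hpads.comp Computable.fst (Computable.list_length.comp Computable.snd)) Computable.snd))
      (Computable.const [])
  · obtain ⟨h₁, h₂, h₃⟩ := hspec π hπ S.length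
    have hne : (pads π S.length).filter (fun x => decide (x ∉ S)) ≠ [] := by
      intro hnil
      have hsub : pads π S.length ⊆ S := by
        intro x hx
        by_contra hxS
        have : x ∈ (pads π S.length).filter fun x => decide (x ∉ S) :=
          List.mem_filter.2 ⟨hx, decide_eq_true hxS⟩
        rw [hnil] at this
        simp at this
      have := (List.subperm_of_subset h₁ hsub).length_le
      omega
    obtain ⟨x, t, hxt⟩ := List.exists_cons_of_ne_nil hne
    have hx : x ∈ (pads π S.length).filter fun x => decide (x ∉ S) := by rw [hxt]; simp
    have hx' := List.mem_filter.1 hx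
    simp only [hxt, List.head?_cons, Option.getD_some]
    exact ⟨of_decide_eq_true hx'.2, h₃ x hx'.1⟩

end Padding

/-! ### Back and forth -/

section BackAndForth

variable {σ : Signature}

/-- A finite partial injection that preserves the meaning of theories, as a list of pairs. -/
structure IsPartialIso (Γ Γ₀ : Formalism σ) (L : List (List Bool × List Bool)) : Prop where
  dom : ∀ x ∈ L, x.1 ∈ Γ.Dom
  eq : ∀ x ∈ L, Γ₀ x.2 = Γ x.1
  inj : ∀ x ∈ L, ∀ y ∈ L, (x.1 = y.1 ↔ x.2 = y.2)

theorem IsPartialIso.swap {Γ Γ₀ : Formalism σ} {L : List (List Bool × List Bool)}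
    (h : IsPartialIso Γ Γ₀ L) : IsPartialIso Γ₀ Γ (L.map Prod.swap) where
  dom x hx := by
    obtain ⟨y, hy, rfl⟩ := List.mem_map.1 hx
    change (Γ₀ y.2).Dom
    rw [h.eq y hy]
    exact h.dom y hy
  eq x hx := by
    obtain ⟨y, hy, rfl⟩ := List.mem_map.1 hx
    exact (h.eq y hy).symm
  inj x hx y hy := by
    obtain ⟨x', hx', rfl⟩ := List.mem_map.1 hx
    obtain ⟨y', hy', rfl⟩ := List.mem_map.1 hy
    exact (h.inj x' hx' y' hy').symm

/-- Extend a list of pairs so that it covers the argument `s` if `a s = true`; the value at `s` is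
chosen by `u`. -/
def extendPairs (a : List Bool → Bool) (u : List Bool × List (List Bool) → List Bool)
    (s : List Bool) (L : List (List Bool × List Bool)) : List (List Bool × List Bool) :=
  bif a s then bif decide (s ∈ L.map Prod.fst) then L else (s, u (s, L.map Prod.snd)) :: L else L

theorem computable_extendPairs {a : List Bool → Bool}
    {u : List Bool × List (List Bool) → List Bool} (ha : Computable a) (hu : Computable u) :
    Computable₂ (extendPairs a u) := by
  have hfst : Primrec fun L : List (List Bool × List Bool) => L.map Prod.fst :=
    Primrec.list_map Primrec.id (Primrec.fst.comp Primrec.snd).to₂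
  have hsnd : Primrec fun L : List (List Bool × List Bool) => L.map Prod.snd :=
    Primrec.list_map Primrec.id (Primrec.snd.comp Primrec.snd).to₂
  refine Computable.cond (ha.comp Computable.fst) (Computable.cond (computable_list_mem.comp
    Computable.fst (hfst.to_comp.comp Computable.snd)) Computable.snd ?_) Computable.snd
  exact Computable.list_cons.comp (Computable.fst.pair (hu.comp
    (Computable.fst.pair (hsnd.to_comp.comp Computable.snd)))) Computable.snd

theorem subset_extendPairs (a : List Bool → Bool)
    (u : List Bool × List (List Bool) → List Bool) (s : List Bool)
    (L : List (List Bool × List Bool)) : L ⊆ extendPairs a u s L := by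
  unfold extendPairs
  cases a s
  · exact List.Subset.refl _
  · by_cases h : s ∈ L.map Prod.fst
    · simp [h]
    · simp [h]

theorem mem_extendPairs {a : List Bool → Bool} (u : List Bool × List (List Bool) → List Bool)
    {s : List Bool} (L : List (List Bool × List Bool)) (hs : a s = true) :
    ∃ t, (s, t) ∈ extendPairs a u s L := by
  unfold extendPairs
  by_cases h : s ∈ L.map Prod.fst
  · obtain ⟨⟨s', t⟩, hx, rfl⟩ := List.mem_map.1 h
    refine ⟨t, ?_⟩
    rw [hs, decide_eq_true h]
    exact hx
  · refine ⟨u (s, L.map Prod.snd), ?_⟩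
    rw [hs, decide_eq_false h]
    exact List.mem_cons_self ..

theorem IsPartialIso.extendPairs {Γ Γ₀ : Formalism σ} {L : List (List Bool × List Bool)}
    (h : IsPartialIso Γ Γ₀ L) {a : List Bool → Bool}
    {u : List Bool × List (List Bool) → List Bool} (ha : ∀ s, a s = true → s ∈ Γ.Dom)
    (hu : ∀ s ∈ Γ.Dom, ∀ S, u (s, S) ∉ S ∧ Γ₀ (u (s, S)) = Γ s) (s : List Bool) :
    IsPartialIso Γ Γ₀ (extendPairs a u s L) := by
  unfold KRF.extendPairs
  cases has : a s
  · exact h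
  by_cases hs : s ∈ L.map Prod.fst
  · rw [decide_eq_true hs]
    exact h
  rw [decide_eq_false hs]
  have hsd := ha s has
  obtain ⟨hnot, heq⟩ := hu s hsd (L.map Prod.snd)
  refine ⟨?_, ?_, ?_⟩
  · intro x hx
    rcases List.mem_cons.1 hx with rfl | hx
    exacts [hsd, h.dom x hx]
  · intro x hx
    rcases List.mem_cons.1 hx with rfl | hx
    exacts [heq, h.eq x hx]
  · intro x hx y hy
    rcases List.mem_cons.1 hx with rfl | hx <;> rcases List.mem_cons.1 hy with rfl | hy
    · simp
    · exact iff_of_false (fun h => hs (List.mem_map.2 ⟨y, hy, h.symm⟩))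
        fun h => hnot (List.mem_map.2 ⟨y, hy, h.symm⟩)
    · exact iff_of_false (fun h => hs (List.mem_map.2 ⟨x, hx, h⟩))
        fun h => hnot (List.mem_map.2 ⟨x, hx, h⟩)
    · exact h.inj x hx y hy

/-- The effective back-and-forth argument: if theories can be translated in both directions while
avoiding finite lists, there is a recursive isomorphism. -/
theorem recursivelyIsomorphic_of_fresh {Γ Γ₀ : Formalism σ}
    (hΓ : ComputablePred fun π => π ∈ Γ.Dom) (hΓ₀ : ComputablePred fun π => π ∈ Γ₀.Dom)
    {u u₀ : List Bool × List (List Bool) → List Bool} (hu : Computable u) (hu₀ : Computable u₀)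
    (huΓ : ∀ π ∈ Γ.Dom, ∀ S, u (π, S) ∉ S ∧ Γ₀ (u (π, S)) = Γ π)
    (huΓ₀ : ∀ π ∈ Γ₀.Dom, ∀ S, u₀ (π, S) ∉ S ∧ Γ (u₀ (π, S)) = Γ₀ π) :
    RecursivelyIsomorphic Γ Γ₀ := by
  obtain ⟨a, ha, hadom⟩ := ComputablePred.computable_iff.1 hΓ
  obtain ⟨a₀, ha₀, hadom₀⟩ := ComputablePred.computable_iff.1 hΓ₀
  have haΓ : ∀ s, s ∈ Γ.Dom ↔ a s = true := fun s => iff_of_eq (congrFun hadom s)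
  have haΓ₀ : ∀ s, s ∈ Γ₀.Dom ↔ a₀ s = true := fun s => iff_of_eq (congrFun hadom₀ s)
  let str : ℕ → List Bool := fun n => (Encodable.decode n).getD []
  have hstr : Computable str := Computable.option_getD Computable.decode (Computable.const _)
  have str_encode : ∀ s, str (Encodable.encode s) = s := fun s => by simp [str]
  -- At step `n`, the `n`-th string is put first into the domain, then into the range.
  let step : ℕ → List (List Bool × List Bool) → List (List Bool × List Bool) := fun n L =>
    (extendPairs a₀ u₀ (str n) ((extendPairs a u (str n) L).map Prod.swap)).map Prod.swap
  let stage : ℕ → List (List Bool × List Bool) := fun n => Nat.rec [] step n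
  have hswap : Computable fun L : List (List Bool × List Bool) => L.map Prod.swap :=
    (Primrec.list_map Primrec.id
      ((Primrec.snd.comp Primrec.snd).pair (Primrec.fst.comp Primrec.snd)).to₂).to_comp
  have hstage : Computable stage := by
    refine Computable.nat_rec (f := fun n : ℕ => n) (g := fun _ => [])
      (h := fun _ p => step p.1 p.2) Computable.id (Computable.const []) ?_
    have hn : Computable fun z : ℕ × (ℕ × List (List Bool × List Bool)) => str z.2.1 :=
      hstr.comp (Computable.fst.comp Computable.snd)
    exact hswap.comp ((computable_extendPairs ha₀ hu₀).comp hn (hswap.comp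
      ((computable_extendPairs ha hu).comp hn (Computable.snd.comp Computable.snd))))
  have iso : ∀ n, IsPartialIso Γ Γ₀ (stage n) := by
    intro n
    induction n with
    | zero => exact ⟨by simp [stage], by simp [stage], by simp [stage]⟩
    | succ n ih =>
      exact ((ih.extendPairs (fun s => (haΓ s).2) huΓ (str n)).swap.extendPairs
        (fun s => (haΓ₀ s).2) huΓ₀ (str n)).swap
  have sub : ∀ n, stage n ⊆ stage (n + 1) := by
    intro n x hx
    have h := subset_extendPairs a₀ u₀ (str n) ((extendPairs a u (str n) (stage n)).map Prod.swap)
      (List.mem_map.2 ⟨x, subset_extendPairs a u (str n) (stage n) hx, rfl⟩)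
    exact List.mem_map.2 ⟨_, h, Prod.swap_swap x⟩
  have mono : ∀ m n, m ≤ n → stage m ⊆ stage n := fun m n hmn =>
    Nat.le_induction (List.Subset.refl _) (fun n _ ih => List.Subset.trans ih (sub n)) n hmn
  have cover : ∀ s ∈ Γ.Dom, ∃ t, (s, t) ∈ stage (Encodable.encode s + 1) := by
    intro s hs
    obtain ⟨t, ht⟩ := mem_extendPairs u (stage (Encodable.encode s)) ((haΓ s).1 hs)
    refine ⟨t, List.mem_map.2 ⟨(t, s), subset_extendPairs _ _ _ _ (List.mem_map.2
      ⟨(s, t), ?_, rfl⟩), rfl⟩⟩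
    rw [str_encode]
    exact ht
  have cover₀ : ∀ t ∈ Γ₀.Dom, ∃ s, (s, t) ∈ stage (Encodable.encode t + 1) := by
    intro t ht
    obtain ⟨s, hs⟩ := mem_extendPairs u₀ ((extendPairs a u t (stage (Encodable.encode t))).map
      Prod.swap) ((haΓ₀ t).1 ht)
    refine ⟨s, List.mem_map.2 ⟨(t, s), ?_, rfl⟩⟩
    rw [str_encode]
    exact hs
  have agree : ∀ m n x y, x ∈ stage m → y ∈ stage n → (x.1 = y.1 ↔ x.2 = y.2) :=
    fun m n x y hx hy => (iso (max m n)).inj x (mono _ _ (le_max_left m n) hx) y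
      (mono _ _ (le_max_right m n) hy)
  let p : List Bool →. List Bool := fun s =>
    ((stage (Encodable.encode s + 1)).lookup s : Option (List Bool))
  have mem_p : ∀ s t, t ∈ p s ↔ ∃ n, (s, t) ∈ stage n := by
    intro s t
    have lookup_mem : ∀ t', (stage (Encodable.encode s + 1)).lookup s = some t' →
        (s, t') ∈ stage (Encodable.encode s + 1) := by
      intro t' h
      obtain ⟨l₁, l₂, h, -⟩ := List.lookup_eq_some_iff.1 h
      rw [h]
      simp
    change t ∈ (↑((stage (Encodable.encode s + 1)).lookup s) : Part (List Bool)) ↔ _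
    rw [Part.mem_coe, Option.mem_def]
    refine ⟨fun h => ⟨Encodable.encode s + 1, lookup_mem t h⟩, ?_⟩
    rintro ⟨n, hn⟩
    obtain ⟨t', ht'⟩ := cover s ((iso n).dom _ hn)
    cases hl : (stage (Encodable.encode s + 1)).lookup s with
    | none =>
      have := List.lookup_eq_none_iff.1 hl _ ht'
      simp at this
    | some t'' =>
      exact congrArg some ((agree (Encodable.encode s + 1) n (s, t'') (s, t)
        (lookup_mem t'' hl) hn).1 rfl)
  have p_dom : p.Dom = Γ.Dom := by
    ext s
    constructor
    · intro hs
      obtain ⟨t, ht⟩ := Part.dom_iff_mem.1 hs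
      obtain ⟨n, hn⟩ := (mem_p s t).1 ht
      exact (iso n).dom _ hn
    · intro hs
      obtain ⟨t, ht⟩ := cover s hs
      exact Part.dom_iff_mem.2 ⟨t, (mem_p s t).2 ⟨Encodable.encode s + 1, ht⟩⟩
  have p_eq : ∀ s t, t ∈ p s → Γ₀ t = Γ s := by
    intro s t h
    obtain ⟨n, hn⟩ := (mem_p s t).1 h
    exact (iso n).eq _ hn
  have p_ran : p.ran ⊆ Γ₀.Dom := by
    rintro t ⟨s, hs⟩
    have hd : s ∈ Γ.Dom := by
      rw [← p_dom]
      exact Part.dom_iff_mem.2 ⟨t, hs⟩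
    change (Γ s).Dom at hd
    rw [← p_eq s t hs] at hd
    exact hd
  refine ⟨p, ⟨⟨?_, ?_⟩, p_dom, p_ran, ?_⟩, ?_, p_ran.antisymm ?_⟩
  · refine Computable.ofOption ((Primrec.listLookup.to_comp.comp Computable.id
      (hstage.comp (Computable.succ.comp Computable.encode))).of_eq fun s => ?_)
    congr 1
    exact lawful_beq_subsingleton _ _
  · rw [p_dom]
    exact hΓ
  · funext s
    rw [PFun.comp_apply]
    by_cases hs : s ∈ Γ.Dom
    · obtain ⟨t, ht⟩ := Part.dom_iff_mem.1 (show (p s).Dom from p_dom.symm.le hs)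
      rw [Part.eq_some_iff.2 ht]
      exact ((Part.bind_some _ _).trans (p_eq s t ht)).symm
    · refine Part.ext' (iff_of_false hs ?_) fun h => absurd h hs
      rintro ⟨h, -⟩
      exact hs (p_dom.le h)
  · intro s s' t hs hs'
    obtain ⟨m, hm⟩ := (mem_p s t).1 hs
    obtain ⟨n, hn⟩ := (mem_p s' t).1 hs'
    exact (agree m n _ _ hm hn).2 rfl
  · intro t ht
    obtain ⟨s, hs⟩ := cover₀ t ht
    exact ⟨s, (mem_p s t).2 ⟨Encodable.encode t + 1, hs⟩⟩

/-- Universal formalisms are recursively isomorphic. -/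
theorem IsUniversalKRF.recursivelyIsomorphic {𝒟 : Set (Database σ)} {𝒬 : Set Sentence}
    {σQ : Signature} (h𝒟 : 𝒟 = allDatabases σ ∨ 𝒟 = positiveDatabases σ)
    (h𝒬 : IsQueryLanguage σQ 𝒬) {Γ Γ₀ : Formalism σ} (hΓ : IsUniversalKRF 𝒟 𝒬 Γ)
    (hΓ₀ : IsUniversalKRF 𝒟 𝒬 Γ₀) : RecursivelyIsomorphic Γ Γ₀ := by
  obtain ⟨u, hu, huΓ⟩ := hΓ.exists_fresh h𝒟 h𝒬 hΓ₀
  obtain ⟨u₀, hu₀, huΓ₀⟩ := hΓ₀.exists_fresh h𝒟 h𝒬 hΓ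
  exact recursivelyIsomorphic_of_fresh hΓ.1.dom_recursive hΓ₀.1.dom_recursive hu hu₀ huΓ huΓ₀

end BackAndForth

end KRF

theorem mainTheorem1 (σD σQ : KRF.Signature)
    (hσD : σD.IsDatabaseSignature) (hσQ : σQ.IsQuerySignature)
    (𝒟 : Set (KRF.Database σD))
    (h𝒟 : 𝒟 = KRF.allDatabases σD ∨ 𝒟 = KRF.positiveDatabases σD)
    (𝒬 : Set KRF.Sentence) (h𝒬 : KRF.IsQueryLanguage σQ 𝒬) :
    (∀ Γ Γ₀ : KRF.Formalism σD, KRF.IsUniversalKRF 𝒟 𝒬 Γ → KRF.IsUniversalKRF 𝒟 𝒬 Γ₀ →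
      KRF.RecursivelyIsomorphic Γ Γ₀) ∧
    KRF.IsUniversalKRF 𝒟 𝒬 (KRF.Theta 𝒟 𝒬) ∧
    (∀ Γ : KRF.Formalism σD, KRF.IsUniversalKRF 𝒟 𝒬 Γ →
      KRF.RecursivelyIsomorphic Γ (KRF.Theta 𝒟 𝒬)) := by
  exact ⟨fun Γ Γ₀ hΓ hΓ₀ => hΓ.recursivelyIsomorphic h𝒟 h𝒬 hΓ₀,
    KRF.isUniversalKRF_theta h𝒟 h𝒬,
    fun Γ hΓ => hΓ.recursivelyIsomorphic h𝒟 h𝒬 (KRF.isUniversalKRF_theta h𝒟 h𝒬)⟩
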